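/- **Setting.** A quantum algorithm $\mathcal A$ applies a unitary to $|0^n\rangle$, measures $k\le n$ qubits in the computational basis, and on outcome $x\in\{0,1\}^k$ outputs $v(\mathcal A)=\phi(x)$, where $\phi:\{0,1\}^k\to\mathbb R$. Let $|\psi\rangle=\mathcal A|0^n\rangle$ and $U=2|\psi\rangle\langle\psi|-I$. The algorithms below know $\phi$, the measured qubits, $B$ and $\varepsilon$, and access $\mathcal A$ only through copies of $|\psi\rangle$ and (controlled) uses of $U$. A run of $\mathcal A$ consumes one copy. $D,c>0$ denote universal constants. "Failure probability $\delta$" is obtained by repeating a procedure $\lceil c\log(1/\delta)\rceil$ times and outputting the median (the upper one if the number of repetitions is even). *Bounded mean* ($0\le\phi\le1$, integer $t$, $\delta$). With $W|x\rangle|0\rangle=|x\rangle(\sqrt{1-\phi(x)}|0\rangle+\sqrt{\phi(x)}|1\rangle)$, perform amplitude estimation with $t$ iterations (iteration operator $(2|\hat\psi\rangle\langle\hat\psi|-I)(I-2P)$, Fourier transform of dimension $t$, output $\sin^2(\pi y/t)$ on outcome $y$) for $|\hat\psi\rangle=W|\psi\rangle|0\rangle$ and $P=I\otimes|1\rangle\langle1|$,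 with failure probability $\delta$. *$\ell_2$ mean* (accuracy $\eta$). Put $K=\lceil\log_2(1/\eta)\rceil$ and $t_0=\lceil D\sqrt{\log_2(1/\eta)}/\eta\rceil$. Let $\mathcal A_{a,b}$ output $v(\mathcal A)$ if $a\le v(\mathcal A)<b$ and $0$ otherwise. Use the bounded-mean procedure with $t=t_0$ on $\mathcal A_{0,1}$ with $\delta=1/10$, giving $\mu_0$, and on $\mathcal A_{2^{\ell-1},2^\ell}/2^\ell$ with $\delta=1/(10K)$, giving $\mu_\ell$, for $\ell=1,\dots,K$. Output $\mu_0+\sum_{\ell=1}^K2^\ell\mu_\ell$. (If $\eta\ge1$, read this as $K=0$ and one trivial iteration, $t_0=1$.) *Algorithm 4* ($B$, $\varepsilon$). Run $\mathcal A$ $\lceil32B\rceil$ times and let $\widetilde m$ be the average output. Apply the $\ell_2$-mean procedure to $\mathcal A/\widetilde m$ (read as output $0$ if $\widetilde m=0$) with accuracy $2\varepsilon/(3(2\sqrt B+1)^2)$ and failure probability $1/8$. Output $\widetilde\mu$, its result multiplied by $\widetilde m$. **Theorem.** The universal constants $D,c$ can be chosen, together with a universal constant $C>0$, so that the following holds.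 Let $\mathcal A$ satisfy $v(\mathcal A)\ge0$ (with probability 1), $\mathbb E[v(\mathcal A)]>0$ and $\mathrm{Var}(v(\mathcal A))/\mathbb E[v(\mathcal A)]^2\le B$ for some $B\ge1$, and let $0<\varepsilon<27B/4$. Then the output $\widetilde\mu$ of Algorithm 4 satisfies $$\Pr\big[\,|\widetilde\mu-\mathbb E[v(\mathcal A)]|\ge\varepsilon\,\mathbb E[v(\mathcal A)]\,\big]\le\tfrac14 .$$ Moreover, in every run it uses at most $$C\big(B+L(1/\varepsilon)\,L(L(1/\varepsilon))\big)$$ copies of $|\psi\rangle$, and uses $U$ at most $$C\,(B/\varepsilon)\,L(B/\varepsilon)^{3/2}\,L(L(B/\varepsilon))$$ times, where $L(x)=\max(1,\log x)$. That is, it uses $O(B+\log(1/\varepsilon)\log\log(1/\varepsilon))$ copies and $O((B/\varepsilon)\log^{3/2}(B/\varepsilon)\log\log(B/\varepsilon))$ uses of $U$. -/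

import Mathlib

open scoped Matrix Kronecker

noncomputable section

namespace QMean

/-! ### Quantum algorithms whose output value has to be averaged -/

/-- Computational basis states of `n` qubits. -/
abbrev Bits (n : ℕ) : Type := Fin n → Fin 2

/-- The classical description of how an `n`-qubit algorithm produces its output: which `k` qubits
are measured at the end, and the function `φ : {0,1}ᵏ → ℝ` applied to the measurement outcome. -/
structure Readout (n k : ℕ) where
  qubits : Fin k ↪ Fin n
  value : Bits k → ℝ

/-- The measurement outcome `x ∈ {0,1}ᵏ` read off from an `n`-qubit basis state. -/
def outcome {n k : ℕ} (q : Fin k ↪ Fin n) (s : Bits n) : Bits k := fun i => s (q i)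

/-- A quantum algorithm `𝒜`: apply a unitary to `|0ⁿ⟩`, measure `k` of the qubits in the
computational basis, and output `φ` of the outcome. -/
structure QuantumAlgorithm (n k : ℕ) extends Readout n k where
  unitary : Matrix.unitaryGroup (Bits n) ℂ

namespace QuantumAlgorithm

variable {n k : ℕ}

/-- The state `|ψ⟩ = 𝒜 |0ⁿ⟩` before the final measurement. -/
def state (A : QuantumAlgorithm n k) : Bits n → ℂ := fun s => A.unitary.1 s 0

/-- Probability of the measurement outcome `x`. -/
def outcomeProb (A : QuantumAlgorithm n k) (x : Bits k) : ℝ :=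
  ∑ s : Bits n, if outcome A.qubits s = x then ‖A.state s‖ ^ 2 else 0

/-- The expectation `𝔼[v(𝒜)]`. -/
def mean (A : QuantumAlgorithm n k) : ℝ := ∑ x, A.outcomeProb x * A.value x

/-- The variance `Var(v(𝒜))`. -/
def variance (A : QuantumAlgorithm n k) : ℝ :=
  ∑ x, A.outcomeProb x * (A.value x - A.mean) ^ 2

end QuantumAlgorithm

/-! ### Programs with access to copies of `|ψ⟩` and to the reflection `U = 2|ψ⟩⟨ψ| - I` -/

/-- The reflection `U = 2|ψ⟩⟨ψ| - I`. -/
def reflection {n : ℕ} (ψ : Bits n → ℂ) : Matrix (Bits n) (Bits n) ℂ :=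
  (2 : ℂ) • Matrix.vecMulVec ψ (star ψ) - 1

/-- Gates on the `n` system qubits together with an ancilla register with basis `R`: a fixed
unitary, which does not depend on `|ψ⟩`, or one use of `U` on the system qubits, controlled
by the set `{r | c r}` of ancilla basis states. -/
inductive Gate (n : ℕ) (R : Type) [Fintype R] [DecidableEq R] : Type
  | fixed (V : Matrix.unitaryGroup (Bits n × R) ℂ) : Gate n R
  | useU (c : R → Bool) : Gate n R

namespace Gate

variable {n : ℕ} {R : Type} [Fintype R] [DecidableEq R]

/-- The operator applied by a gate. -/
def matrix (ψ : Bits n → ℂ) : Gate n R → Matrix (Bits n × R) (Bits n × R) ℂ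
  | fixed V => V.1
  | useU c => Matrix.blockDiagonal fun r => if c r then reflection ψ else 1

/-- The number of uses of `U` in a gate. -/
def uses : Gate n R → ℕ
  | fixed _ => 0
  | useU _ => 1

/-- The state obtained from `|ψ⟩|r₀⟩` by applying the gates of the list one after the other. -/
def finalState (ψ : Bits n → ℂ) (r₀ : R) (gates : List (Gate n R)) : Bits n × R → ℂ :=
  gates.foldl (fun v g => g.matrix ψ *ᵥ v) fun i => if i.2 = r₀ then ψ i.1 else 0

end Gate

/-- A classically controlled program. The instruction `run` takes a fresh copy of `|ψ⟩` and an
ancilla register in the basis state `r₀`, applies the gates, measures everything in the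
computational basis, and continues with the program chosen by the outcome. A program is
given without reference to `|ψ⟩`. -/
inductive Program (n : ℕ) (α : Type) : Type 1
  | pure (a : α) : Program n α
  | run (R : Type) [Fintype R] [DecidableEq R] (r₀ : R) (gates : List (Gate n R))
      (next : Bits n × R → Program n α) : Program n α

namespace Program

variable {n : ℕ} {α β : Type}

/-- The probability that the output lies in `E`, when the program is run with the state `ψ`. -/
def prob (ψ : Bits n → ℂ) (E : Set α) : Program n α → ℝ
  | pure a => E.indicator (fun _ => 1) a
  | @run _ _ _ _ _ r₀ gates next =>
      ∑ o, ‖Gate.finalState ψ r₀ gates o‖ ^ 2 * (next o).prob ψ E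

/-- The number of copies of `|ψ⟩` used, in the worst case over the measurement outcomes. -/
def copies : Program n α → ℕ
  | pure _ => 0
  | @run _ _ _ _ _ _ _ next => 1 + Finset.univ.sup fun o => (next o).copies

/-- The number of uses of `U`, in the worst case over the measurement outcomes. -/
def uses : Program n α → ℕ
  | pure _ => 0
  | @run _ _ _ _ _ _ gates next =>
      (gates.map Gate.uses).sum + Finset.univ.sup fun o => (next o).uses

/-- Run a program, then the program given by its output. -/
def bind : Program n α → (α → Program n β) → Program n β
  | pure a, f => f a
  | @run _ _ R _ _ r₀ gates next, f => run R r₀ gates fun o => (next o).bind f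

/-- Run the programs of a list one after the other and collect their outputs. -/
def sequence : List (Program n α) → Program n (List α)
  | [] => pure []
  | P :: Ps => P.bind fun a => (sequence Ps).bind fun as => pure (a :: as)

end Program

/-- The median of a list (the larger one if the length is even). -/
def median (l : List ℝ) : ℝ := (l.insertionSort (· ≤ ·)).getD (l.length / 2) 0

/-- The number `⌈c log (1/δ)⌉` of repetitions used to reach failure probability `δ`. -/
def repetitions (c δ : ℝ) : ℕ := ⌈c * Real.log (1 / δ)⌉₊

/-- Repeat a program `⌈c log (1/δ)⌉` times and output the median of the results. -/
def powering {n : ℕ} (c δ : ℝ) (P : Program n ℝ) : Program n ℝ :=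
  (Program.sequence (List.replicate (repetitions c δ) P)).bind fun l => Program.pure (median l)

/-- Run the algorithm once: measure a copy of `|ψ⟩` and output the value. -/
def sample {n k : ℕ} (A : Readout n k) : Program n ℝ :=
  Program.run Unit () [] fun o => Program.pure (A.value (outcome A.qubits o.1))

/-! ### Amplitude estimation -/

/-- `|s⟩|r⟩ ↦ |s⟩ (V s |r⟩)`. -/
def onAncilla {n : ℕ} {R : Type} [Fintype R] [DecidableEq R]
    (V : Bits n → Matrix.unitaryGroup R ℂ) : Matrix.unitaryGroup (Bits n × R) ℂ :=
  ⟨Matrix.of fun i j => if i.1 = j.1 then (V i.1).1 i.2 j.2 else 0, by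
    rw [Matrix.mem_unitaryGroup_iff]
    ext ⟨s, r⟩ ⟨s', r'⟩
    have h := congrFun (congrFun (Matrix.mem_unitaryGroup_iff.mp (V s).2) r) r'
    simp only [Matrix.mul_apply, Matrix.star_apply, Matrix.of_apply, Fintype.sum_prod_type] at h ⊢
    by_cases hs : s = s'
    · subst hs
      rw [Finset.sum_eq_single s]
      · simpa [Matrix.one_apply] using h
      · intro b _ hb
        simp [hb.symm]
      · simp
    · rw [Matrix.one_apply_ne (by simp [hs])]
      refine Finset.sum_eq_zero fun b _ => Finset.sum_eq_zero fun c _ => ?_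
      by_cases hb : s = b
      · subst hb
        simp [Ne.symm hs]
      · simp [hb]⟩

/-- The qubit rotation with `|0⟩ ↦ √(1-p)|0⟩ + √p|1⟩`. -/
def rotation (p : unitInterval) : Matrix.unitaryGroup (Fin 2) ℂ :=
  ⟨!![(√(1 - p : ℝ) : ℂ), -(√(p : ℝ) : ℂ); (√(p : ℝ) : ℂ), (√(1 - p : ℝ) : ℂ)], by
    have h1 : ((√(1 - p : ℝ) : ℝ) : ℂ) * (√(1 - p : ℝ) : ℝ) = 1 - ((p : ℝ) : ℂ) := by
      rw [← Complex.ofReal_mul, Real.mul_self_sqrt (by linarith [p.2.2])]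
      push_cast
      rfl
    have h2 : ((√(p : ℝ) : ℝ) : ℂ) * (√(p : ℝ) : ℝ) = ((p : ℝ) : ℂ) := by
      rw [← Complex.ofReal_mul, Real.mul_self_sqrt p.2.1]
    rw [Matrix.mem_unitaryGroup_iff]
    ext i j
    fin_cases i <;> fin_cases j <;>
      simp [Matrix.mul_apply, Fin.sum_univ_two, h1, h2] <;> ring⟩

/-- The quantum Fourier transform of dimension `s + 1`. -/
def fourier (s : ℕ) : Matrix.unitaryGroup (Fin (s + 1)) ℂ :=
  ⟨Matrix.of fun x y => (1 / (√(s + 1 : ℝ) : ℂ)) *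
      Complex.exp (2 * Real.pi * Complex.I * (x : ℕ) * (y : ℕ) / (s + 1 : ℕ)), by
    have ht : ((s + 1 : ℕ) : ℂ) ≠ 0 := by exact_mod_cast s.succ_ne_zero
    have hpi : (2 * Real.pi * Complex.I : ℂ) ≠ 0 := Complex.two_pi_I_ne_zero
    have hsq : (1 / (√(s + 1 : ℝ) : ℂ)) * (1 / (√(s + 1 : ℝ) : ℂ)) = 1 / ((s + 1 : ℕ) : ℂ) := by
      rw [div_mul_div_comm, ← Complex.ofReal_mul, Real.mul_self_sqrt (by positivity)]
      push_cast
      ring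
    rw [Matrix.mem_unitaryGroup_iff]
    ext x z
    set w : ℂ := Complex.exp (2 * Real.pi * Complex.I * ((x : ℕ) - (z : ℕ)) / (s + 1 : ℕ)) with hw
    have key : ∀ y : Fin (s + 1),
        (1 / (√(s + 1 : ℝ) : ℂ)) *
            Complex.exp (2 * Real.pi * Complex.I * (x : ℕ) * (y : ℕ) / (s + 1 : ℕ)) *
          star ((1 / (√(s + 1 : ℝ) : ℂ)) *
            Complex.exp (2 * Real.pi * Complex.I * (z : ℕ) * (y : ℕ) / (s + 1 : ℕ))) =
        1 / ((s + 1 : ℕ) : ℂ) * w ^ (y : ℕ) := by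
      intro y
      rw [star_mul', Complex.star_def, ← Complex.exp_conj, mul_mul_mul_comm,
        ← Complex.exp_add, hw, ← Complex.exp_nat_mul, ← hsq]
      congr 1
      · simp
      · congr 1
        simp only [map_div₀, map_mul, Complex.conj_I, Complex.conj_ofReal, map_natCast, map_ofNat]
        ring
    simp only [Matrix.mul_apply, Matrix.star_apply, Matrix.of_apply]
    rw [Finset.sum_congr rfl fun y _ => key y, ← Finset.mul_sum,
      Fin.sum_univ_eq_sum_range (fun y => w ^ y)]
    by_cases hxz : x = z
    · subst hxz
      have h1 : w = 1 := by simp [hw]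
      rw [h1, Matrix.one_apply_eq]
      simp only [one_pow, Finset.sum_const, Finset.card_range, nsmul_eq_mul, mul_one]
      exact one_div_mul_cancel ht
    · have hwt : w ^ (s + 1) = 1 := by
        rw [hw, ← Complex.exp_nat_mul, Complex.exp_eq_one_iff]
        refine ⟨(x : ℤ) - (z : ℤ), ?_⟩
        rw [mul_div_cancel₀ _ ht]
        push_cast
        ring
      have hw1 : w ≠ 1 := by
        intro h
        rw [hw, Complex.exp_eq_one_iff] at h
        obtain ⟨m, hm⟩ := h
        rw [div_eq_iff ht] at hm
        have h2 : (((x : ℕ) : ℂ) - (z : ℕ)) = m * (s + 1 : ℕ) :=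
          mul_left_cancel₀ hpi (by linear_combination hm)
        have h3 : ((x : ℕ) : ℤ) - ((z : ℕ) : ℤ) = m * ((s + 1 : ℕ) : ℤ) := by exact_mod_cast h2
        have hne : ((x : ℕ) : ℤ) - ((z : ℕ) : ℤ) ≠ 0 := by
          intro h0
          exact hxz (Fin.ext (by omega))
        have hlt : |((x : ℕ) : ℤ) - ((z : ℕ) : ℤ)| < ((s + 1 : ℕ) : ℤ) := by
          rw [abs_lt]
          have := x.2
          have := z.2
          constructor <;> omega
        exact hne (Int.eq_zero_of_abs_lt_dvd ⟨m, by rw [h3]; ring⟩ hlt)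
      rw [geom_sum_eq hw1, hwt, Matrix.one_apply_ne hxz]
      simp⟩

/-- A diagonal gate: the phase `-1` on the ancilla basis states with `c r`. -/
def phase {R : Type} [Fintype R] [DecidableEq R] (c : R → Bool) : Matrix.unitaryGroup R ℂ :=
  ⟨Matrix.diagonal fun r => if c r then -1 else 1, by
    rw [Matrix.mem_unitaryGroup_iff, Matrix.star_eq_conjTranspose, Matrix.diagonal_conjTranspose,
      Matrix.diagonal_mul_diagonal, ← Matrix.diagonal_one]
    congr 1
    ext r
    by_cases h : c r <;> simp [h]⟩

section AmplitudeEstimation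

variable {n k : ℕ} (q : Fin k ↪ Fin n) (φ : Bits k → unitInterval) (s : ℕ)

/-- The operator `W|x⟩|0⟩ = |x⟩(√(1-φ(x))|0⟩ + √(φ(x))|1⟩)` on the measured qubits and the flag
qubit; the ancilla consists of the flag qubit and of the register of the Fourier transform. -/
def gateW : Matrix.unitaryGroup (Bits n × (Fin 2 × Fin (s + 1))) ℂ :=
  onAncilla fun b => ⟨(rotation (φ (outcome q b))).1 ⊗ₖ (1 : Matrix (Fin (s + 1)) (Fin (s + 1)) ℂ),
    Matrix.kronecker_mem_unitary (rotation (φ (outcome q b))).2 (one_mem _)⟩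

/-- The Fourier transform on its register. -/
def gateF : Matrix.unitaryGroup (Bits n × (Fin 2 × Fin (s + 1))) ℂ :=
  onAncilla fun _ => ⟨(1 : Matrix (Fin 2) (Fin 2) ℂ) ⊗ₖ (fourier s).1,
    Matrix.kronecker_mem_unitary (one_mem _) (fourier s).2⟩

/-- The phase `-1` when the flag is `|1⟩` and the register holds some `y ≥ j`; this is `V = I - 2P`
with `P = I ⊗ |1⟩⟨1|`, controlled by `y ≥ j`. -/
def gateV (j : ℕ) : Matrix.unitaryGroup (Bits n × (Fin 2 × Fin (s + 1))) ℂ :=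
  onAncilla fun _ => phase fun r => decide (r.1 = 1 ∧ j ≤ (r.2 : ℕ))

/-- The iterate `(2|ψ̂⟩⟨ψ̂| - I) V` for `|ψ̂⟩ = W|ψ⟩|0⟩`, controlled by `y ≥ j`. The reflection
about `|ψ̂⟩` is `W (U ⊗ |0⟩⟨0| - I ⊗ |1⟩⟨1|) W⁻¹`, so it takes one controlled use of `U`. -/
def iterate (j : ℕ) : List (Gate n (Fin 2 × Fin (s + 1))) :=
  [Gate.fixed (gateV s j),
   Gate.fixed (gateW q φ s)⁻¹,
   Gate.useU fun r => decide (r.1 = 0 ∧ j ≤ (r.2 : ℕ)),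
   Gate.fixed (gateV s j),
   Gate.fixed (gateW q φ s)]

/-- The circuit of amplitude estimation with a register of dimension `t = s + 1`: prepare
`t^(-1/2) ∑ y, |ψ̂⟩|y⟩`, map it to `t^(-1/2) ∑ y, Q^y|ψ̂⟩|y⟩` for the iterate `Q`, and apply the
inverse Fourier transform. -/
def estimationGates : List (Gate n (Fin 2 × Fin (s + 1))) :=
  [Gate.fixed (gateW q φ s), Gate.fixed (gateF s)] ++
    (List.range s).flatMap (fun j => iterate q φ s (j + 1)) ++ [Gate.fixed (gateF s)⁻¹]

/-- Amplitude estimation with `t` iterations (at least one) for `a = ⟨ψ̂|P|ψ̂⟩`, the expectation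
of `φ`: measure the register of dimension `t` and output `sin²(π y / t)`. -/
def amplitudeEstimation (t : ℕ) : Program n ℝ :=
  Program.run (Fin 2 × Fin (t - 1 + 1)) (0, 0) (estimationGates q φ (t - 1)) fun o =>
    Program.pure (Real.sin (Real.pi * (o.2.2 : ℕ) / (t - 1 + 1 : ℕ)) ^ 2)

end AmplitudeEstimation

/-! ### The estimation algorithms -/

/-- Approximating the mean of an output bounded between `0` and `1`: the median of
`⌈c log (1/δ)⌉` runs of amplitude estimation with `t` iterations. -/
def boundedMean {n k : ℕ} (c : ℝ) (q : Fin k ↪ Fin n) (φ : Bits k → unitInterval)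
    (t : ℕ) (δ : ℝ) : Program n ℝ :=
  powering c δ (amplitudeEstimation q φ t)

/-- The output value of the truncated algorithm `𝒜_{a,b}`, divided by `b`. -/
def truncated {k : ℕ} (φ : Bits k → ℝ) (a b : ℝ) (ha : 0 ≤ a) (hb : 0 < b) :
    Bits k → unitInterval := fun x =>
  ⟨if a ≤ φ x ∧ φ x < b then φ x / b else 0, by
    split_ifs with h
    · exact ⟨div_nonneg (ha.trans h.1) hb.le, (div_le_one hb).2 h.2.le⟩
    · simp⟩

/-- Approximating the mean of a nonnegative output with bounded `ℓ₂` norm, with accuracy `η`. -/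
def l2Mean {n k : ℕ} (D c : ℝ) (A : Readout n k) (η : ℝ) : Program n ℝ :=
  let K : ℕ := ⌈Real.logb 2 (1 / η)⌉₊
  let t₀ : ℕ := ⌈D * √(Real.logb 2 (1 / η)) / η⌉₊
  (boundedMean c A.qubits (truncated A.value 0 1 le_rfl one_pos) t₀ (1 / 10)).bind fun μ₀ =>
    (Program.sequence ((List.range K).map fun i =>
      (boundedMean c A.qubits
        (truncated A.value (2 ^ i) (2 ^ (i + 1)) (by positivity) (by positivity)) t₀
        (1 / (10 * K))).bind fun μ => Program.pure (2 ^ (i + 1) * μ))).bind fun l =>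
      Program.pure (μ₀ + l.sum)

/-- The algorithm `𝒜 / m`. -/
def Readout.scale {n k : ℕ} (A : Readout n k) (m : ℝ) : Readout n k where
  qubits := A.qubits
  value := fun x => A.value x / m

/-- Approximating the mean with bounded relative error: run `𝒜` `⌈32 B⌉` times, let `m` be the
average of the results, and apply `l2Mean` to `𝒜 / m` with failure probability `1/8`. -/
def relativeMean {n k : ℕ} (D c : ℝ) (A : Readout n k) (B ε : ℝ) : Program n ℝ :=
  (Program.sequence (List.replicate ⌈32 * B⌉₊ (sample A))).bind fun l =>
    let m : ℝ := l.sum / ⌈32 * B⌉₊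
    (powering c (1 / 8) (l2Mean D c (A.scale m) (2 * ε / (3 * (2 * √B + 1) ^ 2)))).bind fun μ =>
      Program.pure (m * μ)

/-- The logarithm as it is read inside an `O`-bound, never below `1`. -/
def clampLog (x : ℝ) : ℝ := max 1 (Real.log x)

end QMean

end

/-! Algorithm 4 rests on three estimates, combined by union bounds.

Amplitude estimation. With `a = sin² θ`, the iterate rotates by `2θ` in the plane spanned by
`(I-P)|ψ̂⟩` and `P|ψ̂⟩`, so the branch `|y⟩` carries the amplitudes `cos((2y+1)θ)` and
`sin((2y+1)θ)`. After the inverse Fourier transform the outcome `z` is distributed as the average of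
two squared geometric-sum kernels, centred at the phases `θ` and `-θ`. Each kernel has mass at most
`1/4` where `|sin(πz/t ∓ θ)| > 5π/t`; elsewhere `sin²(πz/t)` is within `10π√a/t + 25π²/t²` of `a`
(`prob_amplitudeEstimation_le`). Medians of repeated runs amplify the success probability by a
Chernoff bound (`prob_powering_le`).

The `ℓ₂` mean. Let `X ≥ 0` have second moment `S`. Dropping the values above `2^K` costs at most
`S/2^K ≤ ηS`. On a dyadic level the error is proportional to the square root of the mean of that
level, and Cauchy–Schwarz over the `K` levels bounds the sum of these errors by a multiple of
`√(KS)/t₀`. The factor `√(log(1/η))` in `t₀` cancels `√K`. The total is `η(S + (64√S + 1282)/D)`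
(`sum_error_le`, `prob_l2Mean_le`).

Rescaling. By Chebyshev the average `m` of `⌈32B⌉` samples lies strictly within `μ/2` of the mean
`μ`, except with probability `1/8`. Then `X/m` has second moment at most `4(B+1)`, so for `D = 1500`
the `ℓ₂` error is at most `η(2√B+1)² = 2ε/3`, and `m < 3μ/2` turns it into a relative error below
`ε`. This needs `η < 1/2`. For `η ≥ 1/2` the output of the `ℓ₂` procedure always lies in `[0, 3]`,
while `ε ≥ 27/4`, so the claim holds whenever `m` is good (`prob_relativeMean_le`).

Costs are counted in the worst case. There are `O(log(B/ε) log log(B/ε))` runs of amplitude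
estimation, each with one copy and `t₀ - 1` uses of `U`. In the bound for the copies, `log(B/ε)` is
replaced by `log(1/ε)` because `log² B = O(B)`. -/

noncomputable section

namespace QMean

/-! ### Expectations of program outputs -/

namespace Program

variable {n : ℕ} {α β ι : Type}

/-- The expectation of a function of the output. -/
def expect (ψ : Bits n → ℂ) (f : α → ℝ) : Program n α → ℝ
  | pure a => f a
  | @run _ _ _ _ _ r₀ gates next =>
      ∑ o, ‖Gate.finalState ψ r₀ gates o‖ ^ 2 * (next o).expect ψ f

/-- All outputs that the program can write, whatever the measurement outcomes, satisfy `p`. -/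
def Always (p : α → Prop) : Program n α → Prop
  | pure a => p a
  | @run _ _ _ _ _ _ _ next => ∀ o, (next o).Always p

theorem prob_eq_expect (ψ : Bits n → ℂ) (E : Set α) (P : Program n α) :
    P.prob ψ E = P.expect ψ (E.indicator fun _ => 1) := by
  induction P with
  | pure a => rfl
  | run R r₀ gates next ih => simp only [prob, expect, ih]

theorem expect_bind (ψ : Bits n → ℂ) (g : β → ℝ) (P : Program n α) (f : α → Program n β) :
    (P.bind f).expect ψ g = P.expect ψ fun a => (f a).expect ψ g := by
  induction P with
  | pure a => rfl
  | run R r₀ gates next ih => simp only [bind, expect, ih]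

theorem expect_mono (ψ : Bits n → ℂ) {f g : α → ℝ} (h : ∀ a, f a ≤ g a) (P : Program n α) :
    P.expect ψ f ≤ P.expect ψ g := by
  induction P with
  | pure a => exact h a
  | run R r₀ gates next ih =>
    exact Finset.sum_le_sum fun o _ => mul_le_mul_of_nonneg_left (ih o) (by positivity)

theorem expect_add (ψ : Bits n → ℂ) (f g : α → ℝ) (P : Program n α) :
    P.expect ψ (fun a => f a + g a) = P.expect ψ f + P.expect ψ g := by
  induction P with
  | pure a => rfl
  | run R r₀ gates next ih => simp only [expect, ih, mul_add, Finset.sum_add_distrib]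

theorem expect_const_mul (ψ : Bits n → ℂ) (c : ℝ) (f : α → ℝ) (P : Program n α) :
    P.expect ψ (fun a => c * f a) = c * P.expect ψ f := by
  induction P with
  | pure a => rfl
  | run R r₀ gates next ih =>
    simp only [expect, ih, Finset.mul_sum]
    exact Finset.sum_congr rfl fun o _ => by ring

end Program

/-! ### Unitarity of the gates and normalisation of the states -/

theorem sum_norm_sq_mulVec_unitary {ι : Type*} [Fintype ι] [DecidableEq ι]
    {M : Matrix ι ι ℂ} (hM : M ∈ Matrix.unitaryGroup ι ℂ) (v : ι → ℂ) :
    ∑ i, ‖(M *ᵥ v) i‖ ^ 2 = ∑ i, ‖v i‖ ^ 2 := by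
  have key : ∀ w : ι → ℂ, ((∑ i, ‖w i‖ ^ 2 : ℝ) : ℂ) = star w ⬝ᵥ w := by
    intro w
    simp only [dotProduct, Pi.star_apply, Complex.ofReal_sum]
    refine Finset.sum_congr rfl fun i _ => ?_
    rw [Complex.star_def, Complex.conj_mul']
    push_cast
    rfl
  have : ((∑ i, ‖(M *ᵥ v) i‖ ^ 2 : ℝ) : ℂ) = ((∑ i, ‖v i‖ ^ 2 : ℝ) : ℂ) := by
    rw [key, key, Matrix.star_mulVec, ← Matrix.dotProduct_mulVec, Matrix.mulVec_mulVec,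
      ← Matrix.star_eq_conjTranspose, Matrix.mem_unitaryGroup_iff'.mp hM, Matrix.one_mulVec]
  exact_mod_cast this

theorem star_dotProduct_self_of_sum_norm_sq {ι : Type*} [Fintype ι] {ψ : ι → ℂ}
    (hψ : ∑ b, ‖ψ b‖ ^ 2 = 1) : star ψ ⬝ᵥ ψ = 1 := by
  have h : ((∑ b, ‖ψ b‖ ^ 2 : ℝ) : ℂ) = star ψ ⬝ᵥ ψ := by
    simp only [dotProduct, Pi.star_apply, Complex.ofReal_sum]
    refine Finset.sum_congr rfl fun i _ => ?_
    rw [Complex.star_def, Complex.conj_mul']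
    push_cast
    rfl
  rw [← h, hψ, Complex.ofReal_one]

theorem reflection_mem_unitary {n : ℕ} {ψ : Bits n → ℂ} (hψ : ∑ b, ‖ψ b‖ ^ 2 = 1) :
    reflection ψ ∈ Matrix.unitaryGroup (Bits n) ℂ := by
  have h1 := star_dotProduct_self_of_sum_norm_sq hψ
  have hs : star (reflection ψ) = reflection ψ := by
    simp only [reflection, star_sub, star_smul, star_one, Matrix.star_eq_conjTranspose,
      Matrix.conjTranspose_vecMulVec, star_star]
    simp
  rw [Matrix.mem_unitaryGroup_iff, hs]
  have h2 : Matrix.vecMulVec ψ (star ψ) * Matrix.vecMulVec ψ (star ψ) =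
      Matrix.vecMulVec ψ (star ψ) := by
    rw [Matrix.vecMulVec_mul_vecMulVec, h1]
    simp
  simp only [reflection, sub_mul, mul_sub, smul_mul_assoc, mul_smul_comm, h2, one_mul, mul_one]
  module

theorem Gate.matrix_mem_unitary {n : ℕ} {R : Type} [Fintype R] [DecidableEq R] {ψ : Bits n → ℂ}
    (hψ : ∑ b, ‖ψ b‖ ^ 2 = 1) (g : Gate n R) :
    g.matrix ψ ∈ Matrix.unitaryGroup (Bits n × R) ℂ := by
  cases g with
  | fixed V => exact V.2
  | useU c =>
    rw [Matrix.mem_unitaryGroup_iff, Matrix.star_eq_conjTranspose]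
    simp only [Gate.matrix]
    rw [Matrix.blockDiagonal_conjTranspose, ← Matrix.blockDiagonal_mul,
      ← Matrix.blockDiagonal_one]
    congr 1
    funext r
    have h := Matrix.mem_unitaryGroup_iff.mp (reflection_mem_unitary hψ)
    rw [Matrix.star_eq_conjTranspose] at h
    by_cases hc : c r
    · simpa [hc] using h
    · simp [hc]

theorem Gate.sum_norm_sq_foldl {n : ℕ} {R : Type} [Fintype R] [DecidableEq R] {ψ : Bits n → ℂ}
    (hψ : ∑ b, ‖ψ b‖ ^ 2 = 1) (gates : List (Gate n R)) (v : Bits n × R → ℂ) :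
    ∑ o, ‖gates.foldl (fun v g => g.matrix ψ *ᵥ v) v o‖ ^ 2 = ∑ o, ‖v o‖ ^ 2 := by
  induction gates generalizing v with
  | nil => rfl
  | cons g gs ih =>
    rw [List.foldl_cons, ih, sum_norm_sq_mulVec_unitary (Gate.matrix_mem_unitary hψ g)]

theorem Gate.sum_norm_sq_finalState {n : ℕ} {R : Type} [Fintype R] [DecidableEq R]
    {ψ : Bits n → ℂ} (hψ : ∑ b, ‖ψ b‖ ^ 2 = 1) (r₀ : R) (gates : List (Gate n R)) :
    ∑ o, ‖Gate.finalState ψ r₀ gates o‖ ^ 2 = 1 := by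
  rw [Gate.finalState, Gate.sum_norm_sq_foldl hψ, Fintype.sum_prod_type, ← hψ]
  refine Finset.sum_congr rfl fun b _ => ?_
  rw [Finset.sum_eq_single r₀] <;> simp +contextual

/-! ### Union bounds and sure properties of composed programs -/

namespace Program

variable {n : ℕ} {α β ι : Type} {ψ : Bits n → ℂ}

theorem expect_const (hψ : ∑ b, ‖ψ b‖ ^ 2 = 1) (c : ℝ) (P : Program n α) :
    P.expect ψ (fun _ => c) = c := by
  induction P with
  | pure a => rfl
  | run R r₀ gates next ih =>
    simp only [expect, ih, ← Finset.sum_mul, Gate.sum_norm_sq_finalState hψ, one_mul]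

theorem prob_le_expect {E : Set α} {f : α → ℝ} (h0 : ∀ a, 0 ≤ f a) (h1 : ∀ a ∈ E, 1 ≤ f a)
    (P : Program n α) : P.prob ψ E ≤ P.expect ψ f := by
  rw [prob_eq_expect]
  refine expect_mono ψ (fun a => ?_) P
  by_cases ha : a ∈ E
  · simpa [ha] using h1 a ha
  · simpa [ha] using h0 a

theorem prob_mono {E F : Set α} (h : E ⊆ F) (P : Program n α) : P.prob ψ E ≤ P.prob ψ F := by
  rw [prob_eq_expect, prob_eq_expect]
  exact expect_mono ψ (fun a => Set.indicator_le_indicator_of_subset h (fun _ => zero_le_one) a) P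

theorem prob_le_one (hψ : ∑ b, ‖ψ b‖ ^ 2 = 1) (E : Set α) (P : Program n α) :
    P.prob ψ E ≤ 1 := by
  rw [← expect_const hψ 1 P, prob_eq_expect]
  exact expect_mono ψ (fun a => Set.indicator_le' (fun _ _ => le_rfl) (fun _ _ => zero_le_one) a) P

/-- The union bound for a program that is run after another one. -/
theorem prob_bind_le (hψ : ∑ b, ‖ψ b‖ ^ 2 = 1) {P : Program n α} {f : α → Program n β}
    {E : Set α} {F : Set β} {δ : ℝ} (hδ : 0 ≤ δ) (h : ∀ a ∉ E, (f a).prob ψ F ≤ δ) :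
    (P.bind f).prob ψ F ≤ P.prob ψ E + δ := by
  rw [prob_eq_expect, expect_bind, prob_eq_expect]
  calc P.expect ψ (fun a => (f a).expect ψ (F.indicator fun _ => 1))
      ≤ P.expect ψ (fun a => E.indicator (fun _ => 1) a + δ) := by
        refine expect_mono ψ (fun a => ?_) P
        rw [← prob_eq_expect]
        -- On `E` the continuation may fail with any probability, at most one; off `E` it fails with
        -- probability at most `δ`.
        by_cases ha : a ∈ E
        · simpa [ha] using (prob_le_one hψ F (f a)).trans (le_add_of_nonneg_right hδ)
        · simpa [ha] using h a ha
    _ = _ := by rw [expect_add, expect_const hψ]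

theorem prob_bind_pure (P : Program n α) (f : α → β) (F : Set β) :
    (P.bind fun a => pure (f a)).prob ψ F = P.prob ψ (f ⁻¹' F) := by
  rw [prob_eq_expect, expect_bind, prob_eq_expect]
  rfl

theorem Always.bind {p : α → Prop} {p' : β → Prop} {P : Program n α} {f : α → Program n β}
    (hP : P.Always p) (h : ∀ a, p a → (f a).Always p') : (P.bind f).Always p' := by
  induction P with
  | pure a => exact h a hP
  | run R r₀ gates next ih => exact fun o => ih o (hP o)

theorem always_true (P : Program n α) : P.Always fun _ => True := by
  induction P with
  | pure a => trivial
  | run R r₀ gates next ih => exact fun o => ih o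

theorem Always.prob_eq_zero {p : α → Prop} {P : Program n α} (hP : P.Always p) {E : Set α}
    (h : ∀ a, p a → a ∉ E) : P.prob ψ E = 0 := by
  induction P with
  | pure a => simpa [prob] using h a hP
  | run R r₀ gates next ih =>
    exact Finset.sum_eq_zero fun o _ => by rw [ih o (hP o), mul_zero]

theorem always_sequence_map (is : List ι) {g : ι → Program n α} {p : ι → α → Prop}
    (h : ∀ i ∈ is, (g i).Always (p i)) :
    (sequence (is.map g)).Always fun l => List.Forall₂ p is l := by
  induction is with
  | nil => exact List.Forall₂.nil
  | cons i is ih =>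
    refine (h i (by simp)).bind fun a ha => ?_
    exact (ih fun j hj => h j (by simp [hj])).bind fun l hl => List.Forall₂.cons ha hl

/-- The union bound over a list of runs. The predicate depends on the index because every dyadic
level has its own target and its own error. -/
theorem prob_sequence_map_le (hψ : ∑ b, ‖ψ b‖ ^ 2 = 1) (is : List ι) {g : ι → Program n α}
    {p : ι → α → Prop} {δ : ℝ} (hδ : 0 ≤ δ) (h : ∀ i ∈ is, (g i).prob ψ {a | ¬ p i a} ≤ δ) :
    (sequence (is.map g)).prob ψ {l | ¬ List.Forall₂ p is l} ≤ is.length * δ := by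
  induction is with
  | nil => simp [sequence, prob]
  | cons i is ih =>
    rw [List.map_cons, sequence, List.length_cons]
    refine (prob_bind_le hψ (E := {a | ¬ p i a}) (δ := is.length * δ) (by positivity)
      fun a ha => ?_).trans ?_
    · rw [prob_bind_pure]
      refine (prob_mono ?_ _).trans (ih fun j hj => h j (by simp [hj]))
      intro l hl hl'
      exact hl (List.Forall₂.cons (not_not.mp ha) hl')
    · have := h i (by simp)
      push_cast
      linarith

/-! ### Costs -/

theorem copies_bind_le {P : Program n α} {f : α → Program n β} {p : α → Prop} {b : ℕ}
    (hP : P.Always p) (h : ∀ a, p a → (f a).copies ≤ b) : (P.bind f).copies ≤ P.copies + b := by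
  induction P with
  | pure a => simpa [copies, bind] using h a hP
  | run R r₀ gates next ih =>
    simp only [copies, bind]
    rw [add_assoc]
    gcongr
    refine Finset.sup_le fun o _ => (ih o (hP o)).trans ?_
    gcongr
    exact Finset.le_sup (f := fun o => (next o).copies) (Finset.mem_univ o)

theorem uses_bind_le {P : Program n α} {f : α → Program n β} {p : α → Prop} {b : ℕ}
    (hP : P.Always p) (h : ∀ a, p a → (f a).uses ≤ b) : (P.bind f).uses ≤ P.uses + b := by
  induction P with
  | pure a => simpa [uses, bind] using h a hP
  | run R r₀ gates next ih =>
    simp only [uses, bind]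
    rw [add_assoc]
    gcongr
    refine Finset.sup_le fun o _ => (ih o (hP o)).trans ?_
    gcongr
    exact Finset.le_sup (f := fun o => (next o).uses) (Finset.mem_univ o)

theorem copies_bind_pure (P : Program n α) (f : α → β) :
    (P.bind fun a => pure (f a)).copies ≤ P.copies :=
  copies_bind_le (b := 0) P.always_true fun _ _ => le_rfl

theorem uses_bind_pure (P : Program n α) (f : α → β) :
    (P.bind fun a => pure (f a)).uses ≤ P.uses :=
  uses_bind_le (b := 0) P.always_true fun _ _ => le_rfl

theorem copies_sequence_le {b : ℕ} (Ps : List (Program n α)) (h : ∀ P ∈ Ps, P.copies ≤ b) :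
    (sequence Ps).copies ≤ Ps.length * b := by
  induction Ps with
  | nil => simp [sequence, copies]
  | cons P Ps ih =>
    rw [sequence, List.length_cons, add_mul, one_mul, add_comm]
    refine (copies_bind_le P.always_true fun a _ => (copies_bind_pure _ _).trans
      (ih fun Q hQ => h Q (by simp [hQ]))).trans ?_
    gcongr
    exact h P (by simp)

theorem uses_sequence_le {b : ℕ} (Ps : List (Program n α)) (h : ∀ P ∈ Ps, P.uses ≤ b) :
    (sequence Ps).uses ≤ Ps.length * b := by
  induction Ps with
  | nil => simp [sequence, uses]
  | cons P Ps ih =>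
    rw [sequence, List.length_cons, add_mul, one_mul, add_comm]
    refine (uses_bind_le P.always_true fun a _ => (uses_bind_pure _ _).trans
      (ih fun Q hQ => h Q (by simp [hQ]))).trans ?_
    gcongr
    exact h P (by simp)

end Program

/-! ### Medians of repeated runs -/

theorem median_mem_of_forall {l : List ℝ} {I : Set ℝ} (h : ∀ x ∈ l, x ∈ I) (h0 : (0 : ℝ) ∈ I) :
    median l ∈ I := by
  rw [median, List.getD_eq_getElem?_getD]
  rcases lt_or_ge (l.length / 2) (l.insertionSort (· ≤ ·)).length with hlt | hge
  · rw [List.getElem?_eq_getElem hlt]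
    exact h _ ((List.mem_insertionSort (· ≤ ·)).mp (List.getElem_mem hlt))
  · rw [List.getElem?_eq_none hge]
    exact h0

/-- If the median lies outside an interval, then so does at least half of the list. -/
theorem length_le_two_mul_countP_of_median_notMem (l : List ℝ) {I : Set ℝ} [DecidablePred (· ∈ I)]
    (hI : I.OrdConnected) (h : median l ∉ I) : l.length ≤ 2 * l.countP (fun x => x ∉ I) := by
  set L := l.insertionSort (· ≤ ·) with hL
  have hperm : L.Perm l := List.perm_insertionSort _ l
  have hlen : L.length = l.length := hperm.length_eq
  have hsort : L.Pairwise (· ≤ ·) := List.pairwise_insertionSort (· ≤ ·) l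
  rcases Nat.eq_zero_or_pos l.length with h0 | hpos
  · omega
  have hk : l.length / 2 < L.length := by omega
  rw [← hperm.countP_eq]
  have hm : median l = L[l.length / 2] := by
    rw [median, List.getD_eq_getElem?_getD, ← hL, List.getElem?_eq_getElem hk]
    rfl
  rw [hm] at h
  have hmono : ∀ (i j : ℕ) (hi : i < L.length) (hj : j < L.length), i ≤ j → L[i] ≤ L[j] := by
    intro i j hi hj hij
    rcases hij.lt_or_eq with hlt | rfl
    · exact List.pairwise_iff_getElem.mp hsort i j hi hj hlt
    · exact le_rfl
  -- If `I` has a point below the median, no entry from the median upwards lies in `I`, since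
  -- order-connectedness would then put the median in `I`. Otherwise `I` lies strictly above the
  -- median, and no entry up to the median belongs to it. Both segments contain at least half of the
  -- list, also for the upper median of an even list.
  by_cases hex : ∃ x ∈ I, x ≤ L[l.length / 2]
  · obtain ⟨x, hxI, hx⟩ := hex
    have hall : ∀ y ∈ L.drop (l.length / 2), y ∉ I := by
      intro y hy hyI
      obtain ⟨i, hi, rfl⟩ := List.mem_iff_getElem.mp hy
      rw [List.getElem_drop] at hyI
      exact h (hI.out hxI hyI ⟨hx, hmono _ _ _ _ (Nat.le_add_right _ _)⟩)
    have hc : (L.drop (l.length / 2)).countP (fun x => x ∉ I) = L.length - l.length / 2 := by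
      rw [← List.length_drop, List.countP_eq_length]
      simpa using hall
    have := (List.drop_sublist (l.length / 2) L).countP_le (p := fun x => decide (x ∉ I))
    omega
  · push Not at hex
    have hall : ∀ y ∈ L.take (l.length / 2 + 1), y ∉ I := by
      intro y hy hyI
      obtain ⟨i, hi, rfl⟩ := List.mem_iff_getElem.mp hy
      rw [List.getElem_take] at hyI
      have hi' : i < l.length / 2 + 1 := by
        have := List.length_take_le (l.length / 2 + 1) L
        omega
      exact absurd (hmono i (l.length / 2) (by omega) hk (by omega)) (not_le.mpr (hex _ hyI))
    have hc : (L.take (l.length / 2 + 1)).countP (fun x => x ∉ I) = l.length / 2 + 1 := by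
      rw [List.countP_eq_length.mpr (by simpa using hall), List.length_take]
      omega
    have := (List.take_sublist (l.length / 2 + 1) L).countP_le (p := fun x => decide (x ∉ I))
    omega

theorem Program.always_length_sequence {n : ℕ} {α : Type} (Ps : List (Program n α)) :
    (Program.sequence Ps).Always fun l => l.length = Ps.length := by
  induction Ps with
  | nil => rfl
  | cons P Ps ih =>
    refine P.always_true.bind fun a _ => ih.bind fun l hl => ?_
    simp [Program.Always, hl]

theorem Program.expect_congr_of_always {n : ℕ} {α : Type} {ψ : Bits n → ℂ} {p : α → Prop}
    {P : Program n α} (hP : P.Always p) {f g : α → ℝ} (h : ∀ a, p a → f a = g a) :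
    P.expect ψ f = P.expect ψ g := by
  induction P with
  | pure a => exact h a hP
  | run R r₀ gates next ih =>
    exact Finset.sum_congr rfl fun o _ => by rw [ih o (hP o)]

/-- Independence of the repetitions: the moment generating function of the number of bad runs is a
product. -/
theorem Program.expect_pow_countP_sequence_replicate {n : ℕ} {ψ : Bits n → ℂ} {α : Type}
    (P : Program n α) (p : α → Bool) (a : ℝ) (R : ℕ) :
    (Program.sequence (List.replicate R P)).expect ψ (fun l => a ^ l.countP p) =
      (P.expect ψ fun x => a ^ (if p x then 1 else 0)) ^ R := by
  induction R with
  | zero => simp [Program.sequence, Program.expect]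
  | succ R ih =>
    rw [List.replicate_succ, Program.sequence, Program.expect_bind, pow_succ', ← ih]
    simp only [Program.expect_bind, Program.expect, List.countP_cons, pow_add]
    have : ∀ x, (Program.sequence (List.replicate R P)).expect ψ
        (fun l => a ^ l.countP p * a ^ (if p x then 1 else 0)) =
        (Program.sequence (List.replicate R P)).expect ψ (fun l => a ^ l.countP p) *
          a ^ (if p x then 1 else 0) := by
      intro x
      rw [mul_comm, ← Program.expect_const_mul]
      simp only [mul_comm]
    simp only [this]
    rw [Program.expect_const_mul, mul_comm]

/-- This fixes `c = 8`: since `log(2/√3) = log(4/3)/2 ≥ 1/8`, each repetition gains at least `1/8`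
in the exponent. -/
theorem sqrt_three_div_two_pow_repetitions_le {δ : ℝ} (h0 : 0 < δ) :
    (√3 / 2) ^ repetitions 8 δ ≤ δ := by
  have h3 : 0 < √3 / 2 := by positivity
  rw [← Real.log_le_log_iff (by positivity) h0, Real.log_pow, Real.log_div (by positivity) two_ne_zero,
    Real.log_sqrt (by norm_num)]
  -- The right-hand side is `log(4/3)`, and `log x ≥ 1 - 1/x`.
  have h4 : 1 / 4 ≤ 2 * Real.log 2 - Real.log 3 := by
    have := Real.one_sub_inv_le_log_of_pos (x := 4 / 3) (by norm_num)
    rw [Real.log_div (by norm_num) (by norm_num), show (4 : ℝ) = 2 ^ 2 by norm_num,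
      Real.log_pow] at this
    norm_num at this ⊢
    linarith
  have h5 : 8 * Real.log (1 / δ) ≤ repetitions 8 δ := Nat.le_ceil _
  rw [one_div, Real.log_inv] at h5
  have h6 : (0 : ℝ) ≤ repetitions 8 δ := Nat.cast_nonneg _
  nlinarith

/-- Repetition and the median reduce a failure probability of `1/4` to `δ`. -/
theorem prob_powering_le {n : ℕ} {ψ : Bits n → ℂ} (hψ : ∑ b, ‖ψ b‖ ^ 2 = 1) {δ : ℝ} (hδ : 0 < δ)
    {P : Program n ℝ} {I : Set ℝ} (hI : I.OrdConnected) (hP : P.prob ψ Iᶜ ≤ 1 / 4) :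
    (powering 8 δ P).prob ψ Iᶜ ≤ δ := by
  classical
  set R := repetitions 8 δ with hR
  rw [powering, Program.prob_bind_pure, Program.prob_eq_expect]
  have h3 : 0 < √(3 : ℝ) := by positivity
  -- Chernoff bound with weight `3` on each bad run: one run contributes at most `1 + 2 · 1/4`. A
  -- bad median forces at least half of the runs to be bad, hence total weight at least `√3 ^ R`.
  have hone : P.expect ψ (fun x => (3 : ℝ) ^ (if decide (x ∉ I) = true then 1 else 0)) ≤ 3 / 2 := by
    calc P.expect ψ (fun x => (3 : ℝ) ^ (if decide (x ∉ I) = true then 1 else 0))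
        = P.expect ψ (fun x => 2 * Iᶜ.indicator (fun _ => 1) x + 1) := by
          congr 1
          funext x
          by_cases hx : x ∈ I <;> simp [hx]
          norm_num
      _ = 2 * P.prob ψ Iᶜ + 1 := by
          rw [Program.expect_add, Program.expect_const_mul, Program.expect_const hψ,
            Program.prob_eq_expect]
      _ ≤ 3 / 2 := by linarith
  calc (Program.sequence (List.replicate R P)).expect ψ
        ((fun l => median l) ⁻¹' Iᶜ |>.indicator fun _ => 1)
      ≤ (Program.sequence (List.replicate R P)).expect ψ
        (fun l => (√3)⁻¹ ^ l.length * 3 ^ l.countP (fun x => x ∉ I)) := by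
        refine Program.expect_mono ψ (fun l => ?_) _
        by_cases hl : median l ∈ I
        · simp only [Set.indicator, Set.mem_preimage, Set.mem_compl_iff, hl, not_true, if_false]
          positivity
        · have := length_le_two_mul_countP_of_median_notMem l hI hl
          simp only [Set.indicator, Set.mem_preimage, Set.mem_compl_iff, hl, not_false_iff, if_true]
          rw [inv_pow, ← div_eq_inv_mul, one_le_div (by positivity)]
          calc √3 ^ l.length ≤ √3 ^ (2 * l.countP (fun x => x ∉ I)) :=
                pow_le_pow_right₀ (Real.one_le_sqrt.mpr (by norm_num)) this
            _ = _ := by rw [pow_mul, Real.sq_sqrt (by norm_num)]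
    _ = (√3)⁻¹ ^ R * (Program.sequence (List.replicate R P)).expect ψ
        (fun l => 3 ^ l.countP (fun x => x ∉ I)) := by
        rw [← Program.expect_const_mul]
        refine Program.expect_congr_of_always (Program.always_length_sequence _) fun l hl => ?_
        rw [hl, List.length_replicate]
    _ ≤ (√3)⁻¹ ^ R * (3 / 2) ^ R := by
        rw [Program.expect_pow_countP_sequence_replicate]
        gcongr
        rw [← Program.expect_const (α := ℝ) hψ 0 P]
        exact Program.expect_mono ψ (fun x => by positivity) P
    _ = (√3 / 2) ^ R := by
        rw [← mul_pow]
        congr 1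
        have := Real.mul_self_sqrt (show (0 : ℝ) ≤ 3 by norm_num)
        field_simp
        linarith
    _ ≤ δ := sqrt_three_div_two_pow_repetitions_le hδ

/-- The hypothesis `0 ∈ I` covers the default value `0` of the median of an empty list. -/
theorem always_powering {n : ℕ} {c δ : ℝ} {P : Program n ℝ} {I : Set ℝ} (h0 : (0 : ℝ) ∈ I)
    (hP : P.Always (· ∈ I)) : (powering c δ P).Always (· ∈ I) := by
  have : ∀ R : ℕ, (Program.sequence (List.replicate R P)).Always fun l => ∀ x ∈ l, x ∈ I := by
    intro R
    induction R with
    | zero => exact fun x hx => absurd hx List.not_mem_nil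
    | succ R ih =>
      exact hP.bind fun a ha => ih.bind fun l hl => List.forall_mem_cons.mpr ⟨ha, hl⟩
  exact (this _).bind fun l hl => median_mem_of_forall hl h0

theorem copies_powering_le {n : ℕ} (c δ : ℝ) (P : Program n ℝ) :
    (powering c δ P).copies ≤ repetitions c δ * P.copies := by
  refine (Program.copies_bind_pure _ _).trans ?_
  simpa using Program.copies_sequence_le (b := P.copies) (List.replicate (repetitions c δ) P)
    (fun Q hQ => by rw [List.eq_of_mem_replicate hQ])

theorem uses_powering_le {n : ℕ} (c δ : ℝ) (P : Program n ℝ) :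
    (powering c δ P).uses ≤ repetitions c δ * P.uses := by
  refine (Program.uses_bind_pure _ _).trans ?_
  simpa using Program.uses_sequence_le (b := P.uses) (List.replicate (repetitions c δ) P)
    (fun Q hQ => by rw [List.eq_of_mem_replicate hQ])

/-! ### Chebyshev's inequality for the average of repeated runs -/

namespace Program

variable {n : ℕ} {ψ : Bits n → ℂ}

theorem expect_sum_sequence_replicate (hψ : ∑ b, ‖ψ b‖ ^ 2 = 1) {P : Program n ℝ} {μ : ℝ}
    (h : P.expect ψ (fun x => x - μ) = 0) (N : ℕ) :
    (sequence (List.replicate N P)).expect ψ (fun l => l.sum - N * μ) = 0 := by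
  induction N with
  | zero => simp [sequence, expect]
  | succ N ih =>
    rw [List.replicate_succ, sequence, expect_bind]
    simp only [expect_bind, expect, List.sum_cons]
    have : ∀ x, (sequence (List.replicate N P)).expect ψ
        (fun l => x + l.sum - ((N + 1 : ℕ) : ℝ) * μ) = x - μ := by
      intro x
      rw [← add_zero (x - μ), ← ih, ← expect_const hψ (x - μ) (sequence (List.replicate N P)),
        ← expect_add]
      congr 1
      funext l
      push_cast
      ring
    simp only [this, h]

/-- Variances of independent runs add: the cross term vanishes because the centred sum of the
remaining runs has mean zero. -/
theorem expect_sq_sum_sequence_replicate (hψ : ∑ b, ‖ψ b‖ ^ 2 = 1) {P : Program n ℝ} {μ V : ℝ}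
    (h : P.expect ψ (fun x => x - μ) = 0) (hV : P.expect ψ (fun x => (x - μ) ^ 2) = V) (N : ℕ) :
    (sequence (List.replicate N P)).expect ψ (fun l => (l.sum - N * μ) ^ 2) = N * V := by
  induction N with
  | zero => simp [sequence, expect]
  | succ N ih =>
    rw [List.replicate_succ, sequence, expect_bind]
    simp only [expect_bind, expect, List.sum_cons]
    have : ∀ x, (sequence (List.replicate N P)).expect ψ
        (fun l => (x + l.sum - ((N + 1 : ℕ) : ℝ) * μ) ^ 2) = (x - μ) ^ 2 + N * V := by
      intro x
      have h1 : (fun l : List ℝ => (x + l.sum - ((N + 1 : ℕ) : ℝ) * μ) ^ 2) = fun l =>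
          ((x - μ) ^ 2 + 2 * (x - μ) * (l.sum - N * μ)) + (l.sum - N * μ) ^ 2 := by
        funext l
        push_cast
        ring
      rw [h1, expect_add, expect_add, expect_const hψ, expect_const_mul,
        expect_sum_sequence_replicate hψ h, ih]
      ring
    simp only [this]
    rw [expect_add, hV, expect_const hψ]
    push_cast
    ring

theorem prob_average_sequence_replicate (hψ : ∑ b, ‖ψ b‖ ^ 2 = 1) {P : Program n ℝ} {μ V : ℝ}
    (h : P.expect ψ (fun x => x - μ) = 0) (hV : P.expect ψ (fun x => (x - μ) ^ 2) = V)
    {N : ℕ} (hN : 0 < N) {d : ℝ} (hd : 0 < d) :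
    (sequence (List.replicate N P)).prob ψ {l | d ≤ |l.sum / N - μ|} ≤ V / (N * d ^ 2) := by
  have hN' : (0 : ℝ) < N := Nat.cast_pos.mpr hN
  have hE : V / (N * d ^ 2) = (sequence (List.replicate N P)).expect ψ
      (fun l => 1 / (N * d) ^ 2 * (l.sum - N * μ) ^ 2) := by
    rw [expect_const_mul, expect_sq_sum_sequence_replicate hψ h hV]
    field_simp
  rw [hE]
  refine prob_le_expect (fun l => by positivity) (fun l hl => ?_) _
  have h1 : N * d ≤ |l.sum - N * μ| := by
    have : l.sum - N * μ = N * (l.sum / N - μ) := by field_simp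
    rw [this, abs_mul, abs_of_pos hN']
    exact mul_le_mul_of_nonneg_left hl hN'.le
  rw [one_div_mul_eq_div, one_le_div (by positivity), ← sq_abs (l.sum - N * μ)]
  gcongr

end Program

/-! ### The tail of the distribution of phase estimation -/

theorem inv_sq_le_telescope {u : ℝ} (hu : 1 / 2 < u) :
    1 / u ^ 2 ≤ 1 / (u - 1 / 2) - 1 / (u + 1 / 2) := by
  have h1 : 0 < u - 1 / 2 := by linarith
  rw [div_sub_div _ _ h1.ne' (by linarith), div_le_div_iff₀ (by positivity) (by positivity)]
  nlinarith

/-- The terms telescope by `inv_sq_le_telescope`. The maximum with `k` keeps the bound at zero until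
the summation index enters the tail, so the induction needs no separate starting point. -/
theorem sum_inv_sq_right_tail_le (w : ℝ) {k : ℝ} (hk : 1 ≤ k) (t : ℕ) :
    ∑ z ∈ Finset.range t, (if k < (z : ℝ) - w then 1 / ((z : ℝ) - w) ^ 2 else 0) ≤
      1 / (k - 1 / 2) - 1 / (max ((t : ℝ) - w) k - 1 / 2) := by
  induction t with
  | zero =>
    rw [Finset.sum_range_zero, sub_nonneg]
    refine one_div_le_one_div_of_le (by linarith) (sub_le_sub_right ?_ _)
    exact le_max_right _ _
  | succ t ih =>
    rw [Finset.sum_range_succ]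
    split_ifs with h
    · rw [max_eq_left h.le] at ih
      rw [max_eq_left (by push_cast; linarith)]
      have := inv_sq_le_telescope (u := (t : ℝ) - w) (by linarith)
      have e : ((t + 1 : ℕ) : ℝ) - w - 1 / 2 = (t : ℝ) - w + 1 / 2 := by push_cast; ring
      rw [e]
      linarith
    · rw [max_eq_right (not_lt.mp h), sub_self] at ih
      have : 1 / (max (((t + 1 : ℕ) : ℝ) - w) k - 1 / 2) ≤ 1 / (k - 1 / 2) :=
        one_div_le_one_div_of_le (by linarith) (by gcongr; exact le_max_right _ _)
      linarith

/-- Here the terms grow as the index approaches `w` from the left, so the bound is governed by the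
last distance `w - t + 1`, frozen at `k` once the tail has ended. -/
theorem sum_inv_sq_left_tail_le (w : ℝ) {k : ℝ} (hk : 1 ≤ k) (t : ℕ) :
    ∑ z ∈ Finset.range t, (if k < w - (z : ℝ) then 1 / ((z : ℝ) - w) ^ 2 else 0) ≤
      1 / (max (w - t + 1) k - 1 / 2) := by
  induction t with
  | zero =>
    rw [Finset.sum_range_zero, one_div_nonneg]
    refine sub_nonneg.mpr ((show (1 : ℝ) / 2 ≤ k by linarith).trans ?_)
    exact le_max_right _ _
  | succ t ih =>
    have e : w - ((t + 1 : ℕ) : ℝ) + 1 = w - t := by push_cast; ring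
    rw [Finset.sum_range_succ, e]
    split_ifs with h
    · rw [max_eq_left (by linarith)] at ih
      rw [max_eq_left h.le]
      have := inv_sq_le_telescope (u := w - t) (by linarith)
      have e1 : ((t : ℝ) - w) ^ 2 = (w - t) ^ 2 := by ring
      have e2 : w - t + 1 - 1 / 2 = w - t + 1 / 2 := by ring
      rw [e1]
      rw [e2] at ih
      linarith
    · rw [max_eq_right (not_lt.mp h), add_zero]
      refine ih.trans (one_div_le_one_div_of_le (by linarith) ?_)
      gcongr
      exact le_max_right _ _

theorem sum_inv_sq_tail_le (w : ℝ) {k : ℝ} (hk : 1 ≤ k) (t : ℕ) :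
    ∑ z ∈ Finset.range t, (if k < |(z : ℝ) - w| then 1 / ((z : ℝ) - w) ^ 2 else 0) ≤
      2 / (k - 1 / 2) := by
  have h1 := sum_inv_sq_right_tail_le w hk t
  have h2 := sum_inv_sq_left_tail_le w hk t
  have h3 : 1 / (max (w - t + 1) k - 1 / 2) ≤ 1 / (k - 1 / 2) :=
    one_div_le_one_div_of_le (by linarith) (by gcongr; exact le_max_right _ _)
  have h4 : 0 ≤ 1 / (max ((t : ℝ) - w) k - 1 / 2) :=
    one_div_nonneg.mpr (by linarith [le_max_right ((t : ℝ) - w) k])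
  calc _ ≤ ∑ z ∈ Finset.range t, ((if k < (z : ℝ) - w then 1 / ((z : ℝ) - w) ^ 2 else 0) +
        (if k < w - (z : ℝ) then 1 / ((z : ℝ) - w) ^ 2 else 0)) := by
        refine Finset.sum_le_sum fun z _ => ?_
        have h5 : 0 ≤ 1 / ((z : ℝ) - w) ^ 2 := by positivity
        by_cases h : k < |(z : ℝ) - w|
        · rw [if_pos h]
          rcases lt_abs.mp h with h | h
          · rw [if_pos h]
            split_ifs <;> linarith
          · rw [if_pos (show k < w - z by linarith)]
            split_ifs <;> linarith
        · rw [if_neg h]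
          positivity
    _ ≤ 1 / (k - 1 / 2) + 1 / (k - 1 / 2) := by
        rw [Finset.sum_add_distrib]
        linarith
    _ = 2 / (k - 1 / 2) := by ring

/-- The sine vanishes at `0` and at `π` in this range. Within `π/2` of the nearer zero, Jordan's
inequality `|sin u| ≥ 2|u|/π` applies; adding both poles avoids a case distinction later. -/
theorem inv_sin_sq_le {x : ℝ} (h1 : -(Real.pi / 2) ≤ x) (h2 : x ≤ 3 * Real.pi / 2)
    (h0 : Real.sin x ≠ 0) :
    1 / Real.sin x ^ 2 ≤ Real.pi ^ 2 / 4 * (1 / x ^ 2 + 1 / (x - Real.pi) ^ 2) := by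
  have key : ∀ u : ℝ, |u| ≤ Real.pi / 2 → Real.sin u ≠ 0 →
      1 / Real.sin u ^ 2 ≤ Real.pi ^ 2 / 4 * (1 / u ^ 2) := by
    intro u hu hs
    have hu0 : u ≠ 0 := by
      rintro rfl
      exact hs Real.sin_zero
    have h := Real.mul_abs_le_abs_sin hu
    have h' : (2 / Real.pi * |u|) ^ 2 ≤ Real.sin u ^ 2 := by
      rw [← sq_abs (Real.sin u)]
      have := Real.pi_pos
      gcongr
    rw [mul_pow, sq_abs, div_pow] at h'
    have hpi := Real.pi_pos
    calc 1 / Real.sin u ^ 2 ≤ 1 / (2 ^ 2 / Real.pi ^ 2 * u ^ 2) :=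
          one_div_le_one_div_of_le (by positivity) h'
      _ = _ := by field_simp; norm_num
  have hp : 0 ≤ Real.pi ^ 2 / 4 * (1 / x ^ 2) := by positivity
  have hq : 0 ≤ Real.pi ^ 2 / 4 * (1 / (x - Real.pi) ^ 2) := by positivity
  rw [mul_add]
  rcases le_total x (Real.pi / 2) with h | h
  · have := key x (abs_le.mpr ⟨h1, h⟩) h0
    linarith
  · have := key (x - Real.pi) (abs_le.mpr ⟨by linarith, by linarith⟩)
      (by rwa [Real.sin_sub_pi, neg_ne_zero])
    rw [Real.sin_sub_pi, neg_sq] at this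
    linarith

theorem norm_geom_sum_exp_le {x : ℝ} (h0 : Real.sin x ≠ 0) (t : ℕ) :
    ‖∑ y ∈ Finset.range t, Complex.exp (2 * x * Complex.I) ^ y‖ ≤ 1 / |Real.sin x| := by
  have hn : ‖Complex.exp (2 * x * Complex.I) - 1‖ = 2 * |Real.sin x| := by
    have := Complex.norm_exp_I_mul_ofReal_sub_one (2 * x)
    rw [mul_div_cancel_left₀ x two_ne_zero] at this
    rw [norm_mul, Real.norm_two, Real.norm_eq_abs] at this
    rw [← this, mul_comm _ Complex.I]
    norm_num
  have hpos : 0 < |Real.sin x| := abs_pos.mpr h0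
  have hne : Complex.exp (2 * x * Complex.I) ≠ 1 := by
    intro h
    rw [h, sub_self, norm_zero] at hn
    linarith
  rw [geom_sum_eq hne, norm_div, hn, div_le_div_iff₀ (by positivity) hpos]
  have h1 : ‖Complex.exp (2 * x * Complex.I)‖ = 1 := by
    rw [show (2 * x * Complex.I : ℂ) = ((2 * x : ℝ) : ℂ) * Complex.I by push_cast; ring]
    exact Complex.norm_exp_ofReal_mul_I _
  have : ‖Complex.exp (2 * x * Complex.I) ^ t - 1‖ ≤ 2 := by
    refine (norm_sub_le _ _).trans ?_
    rw [norm_pow, h1, one_pow, norm_one]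
    norm_num
  nlinarith

/-- The kernel is at most `1/(t² sin²)`, hence at most a quarter of the sum of two inverse squares
centred at `w = tθ/π` and `w + t`. Measuring distance by `|sin|` treats phases modulo `π`, so
wrapping around the register causes no loss. -/
theorem sum_norm_sq_geom_sum_tail_le {θ : ℝ} (h1 : -(Real.pi / 2) ≤ θ) (h2 : θ ≤ Real.pi / 2)
    {t : ℕ} (ht : 0 < t) :
    ∑ z ∈ Finset.range t, (if 5 * Real.pi / t < |Real.sin (Real.pi * z / t - θ)| then
      ‖(1 / t : ℂ) * ∑ y ∈ Finset.range t,
        Complex.exp (2 * ((θ - Real.pi * z / t : ℝ) : ℂ) * Complex.I) ^ y‖ ^ 2 else 0) ≤ 1 / 4 := by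
  have hpi := Real.pi_pos
  have ht' : (0 : ℝ) < t := Nat.cast_pos.mpr ht
  set w := t * θ / Real.pi with hw
  have hterm : ∀ z ∈ Finset.range t,
      (if 5 * Real.pi / t < |Real.sin (Real.pi * z / t - θ)| then
      ‖(1 / t : ℂ) * ∑ y ∈ Finset.range t,
        Complex.exp (2 * ((θ - Real.pi * z / t : ℝ) : ℂ) * Complex.I) ^ y‖ ^ 2 else 0) ≤
      1 / 4 * ((if 5 < |(z : ℝ) - w| then 1 / ((z : ℝ) - w) ^ 2 else 0) +
        (if 5 < |(z : ℝ) - (w + t)| then 1 / ((z : ℝ) - (w + t)) ^ 2 else 0)) := by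
    intro z hz
    have hz' : (z : ℝ) ≤ t := by exact_mod_cast (Finset.mem_range.mp hz).le
    set x := Real.pi * z / t - θ with hx
    have e1 : x = Real.pi / t * (z - w) := by rw [hx, hw]; field_simp
    have e2 : x - Real.pi = Real.pi / t * (z - (w + t)) := by rw [hx, hw]; field_simp; ring
    by_cases h : 5 * Real.pi / t < |Real.sin x|
    · rw [if_pos h]
      have h0 : Real.sin x ≠ 0 := by
        intro h0
        rw [h0, abs_zero] at h
        exact absurd h (not_lt.mpr (by positivity))
      have hc : 5 * Real.pi / t = Real.pi / t * 5 := by ring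
      have hpt : 0 < Real.pi / t := by positivity
      have g1 : 5 < |(z : ℝ) - w| := by
        have := h.trans_le Real.abs_sin_le_abs
        rw [e1, abs_mul, abs_of_pos hpt, hc] at this
        exact lt_of_mul_lt_mul_left this hpt.le
      -- Since `|sin(x - π)| = |sin x|`, the point is also far from the second pole.
      have g2 : 5 < |(z : ℝ) - (w + t)| := by
        have h' := h
        rw [← abs_neg, ← Real.sin_sub_pi] at h'
        have := h'.trans_le Real.abs_sin_le_abs
        rw [e2, abs_mul, abs_of_pos hpt, hc] at this
        exact lt_of_mul_lt_mul_left this hpt.le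
      rw [if_pos g1, if_pos g2]
      have hneg : Real.sin (θ - Real.pi * z / t) = - Real.sin x := by
        rw [← Real.sin_neg, hx, neg_sub]
      have hs := norm_geom_sum_exp_le (x := θ - Real.pi * z / t)
        (by rw [hneg]; exact neg_ne_zero.mpr h0) t
      rw [hneg, abs_neg] at hs
      have hx1 : -(Real.pi / 2) ≤ x := by
        have : 0 ≤ Real.pi * z / t := by positivity
        linarith
      have hx2 : x ≤ 3 * Real.pi / 2 := by
        have : Real.pi * z / t ≤ Real.pi := by
          rw [div_le_iff₀ ht']
          exact mul_le_mul_of_nonneg_left hz' hpi.le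
        linarith
      calc _ ≤ ((1 / t) * (1 / |Real.sin x|)) ^ 2 := by
            rw [norm_mul]
            gcongr
            simp
        _ = 1 / t ^ 2 * (1 / Real.sin x ^ 2) := by
            rw [mul_pow, div_pow, div_pow, sq_abs, one_pow]
        _ ≤ 1 / t ^ 2 * (Real.pi ^ 2 / 4 * (1 / x ^ 2 + 1 / (x - Real.pi) ^ 2)) := by
            gcongr
            exact inv_sin_sq_le hx1 hx2 h0
        _ = _ := by
            rw [e2, e1, mul_pow, mul_pow]
            have n1 : (z : ℝ) - w ≠ 0 := by
              intro h
              rw [h, abs_zero] at g1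
              norm_num at g1
            have n2 : (z : ℝ) - (w + t) ≠ 0 := by
              intro h
              rw [h, abs_zero] at g2
              norm_num at g2
            field_simp
    · rw [if_neg h]
      positivity
  refine (Finset.sum_le_sum hterm).trans ?_
  rw [← Finset.mul_sum, Finset.sum_add_distrib]
  -- Each tail is at most `2/(5 - 1/2) = 4/9`, and a quarter of the two together is `2/9 ≤ 1/4`.
  have := sum_inv_sq_tail_le w (k := 5) (by norm_num) t
  have := sum_inv_sq_tail_le (w + t) (k := 5) (by norm_num) t
  norm_num at *
  linarith

/-- Phase errors bound the error of the estimated amplitude. -/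
theorem abs_sin_sq_sub_sin_sq_le {x θ r : ℝ} (h : |Real.sin (x - θ)| ≤ r) :
    |Real.sin x ^ 2 - Real.sin θ ^ 2| ≤ 2 * |Real.sin θ| * r + r ^ 2 := by
  have e : Real.sin x ^ 2 - Real.sin θ ^ 2 =
      Real.sin (x - θ) * (2 * Real.sin θ * (Real.cos θ * Real.cos (x - θ)) +
        Real.sin (x - θ) * Real.cos (2 * θ)) := by
    have hx : Real.sin x = Real.sin (x - θ) * Real.cos θ + Real.cos (x - θ) * Real.sin θ := by
      rw [← Real.sin_add, sub_add_cancel]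
    rw [hx, Real.cos_two_mul]
    have h1 := Real.sin_sq_add_cos_sq θ
    have h2 := Real.sin_sq_add_cos_sq (x - θ)
    linear_combination Real.sin θ ^ 2 * h2 - Real.sin (x - θ) ^ 2 * h1
  have hr : 0 ≤ r := (abs_nonneg _).trans h
  have h1 : |Real.cos θ * Real.cos (x - θ)| ≤ 1 := by
    rw [abs_mul]
    exact mul_le_one₀ (Real.abs_cos_le_one _) (abs_nonneg _) (Real.abs_cos_le_one _)
  rw [e, abs_mul]
  calc _ ≤ r * (2 * |Real.sin θ| * 1 + r * 1) := by
        refine mul_le_mul h ((abs_add_le _ _).trans (add_le_add ?_ ?_)) (abs_nonneg _) hr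
        · rw [abs_mul, abs_mul, abs_two]
          gcongr
        · rw [abs_mul]
          exact mul_le_mul h (Real.abs_cos_le_one _) (abs_nonneg _) hr
    _ = _ := by ring

/-! ### The state produced by amplitude estimation -/

section OnAncilla

variable {n : ℕ} {R : Type} [Fintype R] [DecidableEq R]

theorem onAncilla_mulVec (V : Bits n → Matrix.unitaryGroup R ℂ) (v : Bits n × R → ℂ)
    (o : Bits n × R) :
    ((onAncilla V).1 *ᵥ v) o = ∑ r, (V o.1).1 o.2 r * v (o.1, r) := by
  simp only [onAncilla, Matrix.mulVec, dotProduct, Matrix.of_apply, Fintype.sum_prod_type]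
  rw [Finset.sum_eq_single o.1]
  · simp
  · intro b _ hb
    simp [hb.symm]
  · simp

theorem onAncilla_inv_mulVec (V : Bits n → Matrix.unitaryGroup R ℂ) (v : Bits n × R → ℂ)
    (o : Bits n × R) :
    ((onAncilla V)⁻¹.1 *ᵥ v) o = ∑ r, star ((V o.1).1 r o.2) * v (o.1, r) := by
  have : (onAncilla V)⁻¹.1 = star (onAncilla V).1 := rfl
  rw [this]
  simp only [onAncilla, Matrix.mulVec, dotProduct, Matrix.star_apply, Matrix.of_apply,
    Fintype.sum_prod_type]
  rw [Finset.sum_eq_single o.1]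
  · simp
  · intro b _ hb
    simp [hb]
  · simp

end OnAncilla

section EstimationState

variable {n k : ℕ} {s : ℕ}

/-- The vector with given components for the flags `|0⟩` and `|1⟩`. -/
def flagState (g₀ g₁ : Bits n → Fin (s + 1) → ℂ) : Bits n × (Fin 2 × Fin (s + 1)) → ℂ :=
  fun o => if o.2.1 = 0 then g₀ o.1 o.2.2 else g₁ o.1 o.2.2

theorem flagState_ext {v : Bits n × (Fin 2 × Fin (s + 1)) → ℂ} {g₀ g₁ : Bits n → Fin (s + 1) → ℂ}
    (h0 : ∀ b y, v (b, (0, y)) = g₀ b y) (h1 : ∀ b y, v (b, (1, y)) = g₁ b y) :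
    v = flagState g₀ g₁ := by
  funext ⟨b, f, y⟩
  fin_cases f
  · exact h0 b y
  · exact h1 b y

variable (q : Fin k ↪ Fin n) (φ : Bits k → unitInterval)

/-- The amplitude `√(1-φ)` of the flag `|0⟩`. -/
def cosAmp (b : Bits n) : ℂ := (√(1 - φ (outcome q b) : ℝ) : ℝ)

/-- The amplitude `√φ` of the flag `|1⟩`. -/
def sinAmp (b : Bits n) : ℂ := (√(φ (outcome q b) : ℝ) : ℝ)

theorem cosAmp_sq (b : Bits n) : cosAmp q φ b ^ 2 = 1 - ((φ (outcome q b) : ℝ) : ℂ) := by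
  rw [cosAmp, ← Complex.ofReal_pow, Real.sq_sqrt (by linarith [(φ (outcome q b)).2.2])]
  push_cast
  rfl

theorem sinAmp_sq (b : Bits n) : sinAmp q φ b ^ 2 = ((φ (outcome q b) : ℝ) : ℂ) := by
  rw [sinAmp, ← Complex.ofReal_pow, Real.sq_sqrt (φ (outcome q b)).2.1]

theorem gateW_mulVec (g₀ g₁ : Bits n → Fin (s + 1) → ℂ) :
    (gateW q φ s).1 *ᵥ flagState g₀ g₁ =
      flagState (fun b y => cosAmp q φ b * g₀ b y - sinAmp q φ b * g₁ b y)
        (fun b y => sinAmp q φ b * g₀ b y + cosAmp q φ b * g₁ b y) := by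
  apply flagState_ext <;> intro b y <;> rw [gateW, onAncilla_mulVec] <;>
    simp [rotation, flagState, Fintype.sum_prod_type, Fin.sum_univ_two, Matrix.kroneckerMap_apply,
      Matrix.one_apply, cosAmp, sinAmp, sub_eq_add_neg]

theorem gateW_inv_mulVec (g₀ g₁ : Bits n → Fin (s + 1) → ℂ) :
    (gateW q φ s)⁻¹.1 *ᵥ flagState g₀ g₁ =
      flagState (fun b y => cosAmp q φ b * g₀ b y + sinAmp q φ b * g₁ b y)
        (fun b y => -(sinAmp q φ b * g₀ b y) + cosAmp q φ b * g₁ b y) := by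
  apply flagState_ext <;> intro b y <;> rw [gateW, onAncilla_inv_mulVec] <;>
    simp [rotation, flagState, Fintype.sum_prod_type, Fin.sum_univ_two, Matrix.kroneckerMap_apply,
      Matrix.one_apply, cosAmp, sinAmp, apply_ite (starRingEnd ℂ)]

theorem gateV_mulVec (j : ℕ) (g₀ g₁ : Bits n → Fin (s + 1) → ℂ) :
    (gateV s j).1 *ᵥ flagState g₀ g₁ =
      flagState g₀ (fun b y => if j ≤ (y : ℕ) then -g₁ b y else g₁ b y) := by
  apply flagState_ext <;> intro b y <;> rw [gateV, onAncilla_mulVec] <;>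
    simp [phase, flagState, Matrix.diagonal_apply, Fintype.sum_prod_type, Fin.sum_univ_two]

theorem gateF_mulVec (g₀ g₁ : Bits n → Fin (s + 1) → ℂ) :
    (gateF s).1 *ᵥ flagState g₀ g₁ =
      flagState (fun b y => ∑ z, (fourier s).1 y z * g₀ b z)
        (fun b y => ∑ z, (fourier s).1 y z * g₁ b z) := by
  apply flagState_ext <;> intro b y <;> rw [gateF, onAncilla_mulVec] <;>
    simp [flagState, Fintype.sum_prod_type, Fin.sum_univ_two, Matrix.kroneckerMap_apply,
      Matrix.one_apply]

theorem gateF_inv_mulVec (g₀ g₁ : Bits n → Fin (s + 1) → ℂ) :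
    (gateF s)⁻¹.1 *ᵥ flagState g₀ g₁ =
      flagState (fun b y => ∑ z, star ((fourier s).1 z y) * g₀ b z)
        (fun b y => ∑ z, star ((fourier s).1 z y) * g₁ b z) := by
  apply flagState_ext <;> intro b y <;> rw [gateF, onAncilla_inv_mulVec] <;>
    simp [flagState, Fintype.sum_prod_type, Fin.sum_univ_two, Matrix.kroneckerMap_apply,
      Matrix.one_apply]

variable {ψ : Bits n → ℂ}

theorem useU_mulVec (j : ℕ) (g₀ g₁ : Bits n → Fin (s + 1) → ℂ) :
    (Gate.useU fun r : Fin 2 × Fin (s + 1) => decide (r.1 = 0 ∧ j ≤ (r.2 : ℕ))).matrix ψ *ᵥ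
        flagState g₀ g₁ =
      flagState (fun b y => if j ≤ (y : ℕ) then
        2 * ψ b * ∑ b', star (ψ b') * g₀ b' y - g₀ b y else g₀ b y) g₁ := by
  have key : ∀ (c : Fin 2 × Fin (s + 1) → Bool) (v : Bits n × (Fin 2 × Fin (s + 1)) → ℂ)
      (b : Bits n) (r : Fin 2 × Fin (s + 1)),
      ((Gate.useU c).matrix ψ *ᵥ v) (b, r) =
        if c r then 2 * ψ b * ∑ b', star (ψ b') * v (b', r) - v (b, r) else v (b, r) := by
    intro c v b r
    simp only [Gate.matrix, Matrix.mulVec, dotProduct, Matrix.blockDiagonal_apply,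
      Fintype.sum_prod_type]
    have h1 : ∀ x : Bits n, ∑ y, (if r = y then
        (if c r = true then reflection ψ else (1 : Matrix (Bits n) (Bits n) ℂ)) b x
        else 0) * v (x, y) =
        (if c r = true then reflection ψ else (1 : Matrix (Bits n) (Bits n) ℂ)) b x * v (x, r) := by
      intro x
      simp
    simp only [← Fintype.sum_prod_type']
    rw [Fintype.sum_prod_type, Finset.sum_congr rfl fun x _ => h1 x]
    by_cases hc : c r
    · simp only [hc, if_true, reflection, Matrix.sub_apply, Matrix.smul_apply,
        Matrix.vecMulVec_apply, sub_mul, Finset.sum_sub_distrib, Matrix.one_apply, ite_mul,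
        one_mul, zero_mul, Finset.sum_ite_eq, Finset.mem_univ, Finset.mul_sum, Pi.star_apply,
        smul_eq_mul]
      congr 1
      exact Finset.sum_congr rfl fun x _ => by ring
    · simp [hc, Matrix.one_apply]
  apply flagState_ext <;> intro b y <;> rw [key] <;> simp [flagState]

/-- The coefficients of `(I-P)|ψ̂⟩` and `P|ψ̂⟩` after `j` iterations, where `a = ⟨ψ̂|P|ψ̂⟩`. -/
def iterateCoeff (a : ℝ) : ℕ → ℝ × ℝ
  | 0 => (1, 1)
  | j + 1 =>
    let v := iterateCoeff a j
    (2 * (v.1 * (1 - a) - v.2 * a) - v.1, 2 * (v.1 * (1 - a) - v.2 * a) + v.2)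

/-- One iteration is a rotation by `2θ`. The coefficients refer to the unnormalised vectors
`(I-P)|ψ̂⟩` and `P|ψ̂⟩`, of norms `|cos θ|` and `|sin θ|`, so `a = 0` and `a = 1` need no special
treatment. -/
theorem cos_mul_iterateCoeff (θ : ℝ) (j : ℕ) :
    Real.cos θ * (iterateCoeff (Real.sin θ ^ 2) j).1 = Real.cos ((2 * j + 1) * θ) ∧
      Real.sin θ * (iterateCoeff (Real.sin θ ^ 2) j).2 = Real.sin ((2 * j + 1) * θ) := by
  induction j with
  | zero => simp [iterateCoeff]
  | succ j ih =>
    obtain ⟨h1, h2⟩ := ih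
    set v := iterateCoeff (Real.sin θ ^ 2) j with hv
    have e : (2 * ((j + 1 : ℕ) : ℝ) + 1) * θ = (2 * j + 1) * θ + 2 * θ := by push_cast; ring
    have hs := Real.sin_sq_add_cos_sq θ
    rw [e, Real.cos_add, Real.sin_add, ← h1, ← h2, Real.cos_two_mul, Real.sin_two_mul]
    simp only [iterateCoeff, ← hv]
    constructor
    · linear_combination (-(2 * Real.cos θ * v.1)) * hs
    · linear_combination (-(2 * Real.sin θ * v.1) - 2 * Real.sin θ * v.2) * hs

/-- The state after `j` iterations, in which the branch `|y⟩` has been iterated `min j y` times. -/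
def iterateState (ψ : Bits n → ℂ) (s : ℕ) (a : ℝ) (j : ℕ) : Bits n × (Fin 2 × Fin (s + 1)) → ℂ :=
  flagState
    (fun b y => 1 / (√(s + 1 : ℝ) : ℂ) * ((iterateCoeff a (min j y)).1 : ℂ) * cosAmp q φ b * ψ b)
    (fun b y => 1 / (√(s + 1 : ℝ) : ℂ) * ((iterateCoeff a (min j y)).2 : ℂ) * sinAmp q φ b * ψ b)

theorem foldl_iterate (hψ : ∑ b, ‖ψ b‖ ^ 2 = 1) {a : ℝ}
    (ha : a = ∑ b, ‖ψ b‖ ^ 2 * (φ (outcome q b) : ℝ)) (j : ℕ) :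
    (iterate q φ s (j + 1)).foldl (fun v g => g.matrix ψ *ᵥ v) (iterateState q φ ψ s a j) =
      iterateState q φ ψ s a (j + 1) := by
  -- This is the inner product of `|ψ̂⟩` with the iterated state after `V`, computed as the overlap
  -- with `|ψ⟩|0⟩` after `W⁻¹`. The arguments `α`, `β` are the two coefficients and `c` the
  -- amplitude of the Fourier branch.
  have hsum : ∀ c α β : ℂ, ∑ b, star (ψ b) * (cosAmp q φ b * (c * α * cosAmp q φ b * ψ b) +
      sinAmp q φ b * -(c * β * sinAmp q φ b * ψ b)) = c * (α * (1 - (a : ℂ)) - β * (a : ℂ)) := by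
    intro c α β
    have h1 : (1 : ℂ) = ∑ b, ((‖ψ b‖ ^ 2 : ℝ) : ℂ) := by rw [← Complex.ofReal_sum, hψ]; simp
    have h2 : (a : ℂ) = ∑ b, ((‖ψ b‖ ^ 2 : ℝ) : ℂ) * ((φ (outcome q b) : ℝ) : ℂ) := by
      rw [ha]
      push_cast
      rfl
    have h3 : c * (α * (1 - (a : ℂ)) - β * (a : ℂ)) = c * α * 1 - c * (α + β) * a := by ring
    rw [h3]
    conv_rhs => rw [h1, h2]
    rw [Finset.mul_sum, Finset.mul_sum, ← Finset.sum_sub_distrib]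
    refine Finset.sum_congr rfl fun b _ => ?_
    have h4 : ((‖ψ b‖ ^ 2 : ℝ) : ℂ) = star (ψ b) * ψ b := by
      rw [Complex.star_def, Complex.conj_mul']
      push_cast
      rfl
    rw [h4]
    linear_combination (star (ψ b) * ψ b * c * α) * cosAmp_sq q φ b -
      (star (ψ b) * ψ b * c * β) * sinAmp_sq q φ b
  have hcs : ∀ b, cosAmp q φ b ^ 2 + sinAmp q φ b ^ 2 = 1 := by
    intro b
    rw [cosAmp_sq, sinAmp_sq, sub_add_cancel]
  simp only [iterate, List.foldl_cons, List.foldl_nil, Gate.matrix.eq_1, iterateState]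
  rw [gateV_mulVec, gateW_inv_mulVec, useU_mulVec, gateV_mulVec, gateW_mulVec]
  apply Eq.symm
  apply flagState_ext <;> intro b y <;> by_cases hy : j + 1 ≤ (y : ℕ)
  · simp only [flagState, hy, if_pos, hsum, min_eq_left hy,
      min_eq_left ((Nat.le_succ j).trans hy), iterateCoeff]
    push_cast
    linear_combination (1 / (√(s + 1 : ℝ) : ℂ) * ((iterateCoeff a j).1 : ℂ) * cosAmp q φ b * ψ b) *
      hcs b
  -- The controls are inactive on this branch, so only `W W⁻¹ = 1` remains.
  · have hy' : (y : ℕ) ≤ j := by omega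
    simp only [flagState, hy, if_neg, not_false_iff, min_eq_right hy',
      min_eq_right (hy'.trans (Nat.le_succ j))]
    push_cast
    linear_combination (-1 / (√(s + 1 : ℝ) : ℂ) * ((iterateCoeff a y).1 : ℂ) * cosAmp q φ b * ψ b) *
      hcs b
  · simp only [flagState, hy, if_pos, hsum, min_eq_left hy,
      min_eq_left ((Nat.le_succ j).trans hy), iterateCoeff]
    push_cast
    linear_combination (-1 / (√(s + 1 : ℝ) : ℂ) * ((iterateCoeff a j).2 : ℂ) * sinAmp q φ b * ψ b) *
      hcs b
  · have hy' : (y : ℕ) ≤ j := by omega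
    simp only [flagState, hy, if_neg, not_false_iff, min_eq_right hy',
      min_eq_right (hy'.trans (Nat.le_succ j))]
    push_cast
    linear_combination (-1 / (√(s + 1 : ℝ) : ℂ) * ((iterateCoeff a y).2 : ℂ) * sinAmp q φ b * ψ b) *
      hcs b

theorem foldl_estimationGates (hψ : ∑ b, ‖ψ b‖ ^ 2 = 1) {a : ℝ}
    (ha : a = ∑ b, ‖ψ b‖ ^ 2 * (φ (outcome q b) : ℝ)) :
    Gate.finalState ψ ((0, 0) : Fin 2 × Fin (s + 1)) (estimationGates q φ s) =
      (gateF s)⁻¹.1 *ᵥ iterateState q φ ψ s a s := by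
  have h0 : (fun i : Bits n × (Fin 2 × Fin (s + 1)) => if i.2 = (0, 0) then ψ i.1 else 0) =
      flagState (fun b y => if y = 0 then ψ b else 0) (fun _ _ => 0) := by
    apply flagState_ext <;> intro b y <;> simp
  have h1 : (gateF s).1 *ᵥ ((gateW q φ s).1 *ᵥ
      flagState (fun b y => if y = 0 then ψ b else 0) (fun _ _ => 0)) =
        iterateState q φ ψ s a 0 := by
    rw [gateW_mulVec, gateF_mulVec, iterateState]
    congr 1 <;> funext b y <;> simp [iterateCoeff, fourier] <;> ring
  have h2 : ∀ j, ((List.range j).flatMap fun j => iterate q φ s (j + 1)).foldl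
      (fun v g => g.matrix ψ *ᵥ v) (iterateState q φ ψ s a 0) = iterateState q φ ψ s a j := by
    intro j
    induction j with
    | zero => rfl
    | succ j ih =>
      rw [List.range_succ, List.flatMap_append, List.foldl_append, ih, List.flatMap_singleton,
        foldl_iterate q φ hψ ha]
  rw [Gate.finalState, estimationGates, h0, List.foldl_append, List.foldl_append]
  simp only [List.foldl_cons, List.foldl_nil, Gate.matrix.eq_1, h1, h2]

/-- The amplitude of the outcome `z` in the inverse Fourier transform of `f`. -/
def fourierAmp (s : ℕ) (f : ℕ → ℝ) (z : ℕ) : ℂ :=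
  1 / ((s + 1 : ℕ) : ℂ) * ∑ y ∈ Finset.range (s + 1),
    Complex.exp (-(2 * Real.pi * Complex.I * y * z / (s + 1 : ℕ))) * (f y : ℂ)

theorem fourierAmp_const_mul (c : ℝ) (f : ℕ → ℝ) (z : ℕ) :
    fourierAmp s (fun y => c * f y) z = c * fourierAmp s f z := by
  simp only [fourierAmp, Finset.mul_sum]
  refine Finset.sum_congr rfl fun y _ => ?_
  push_cast
  ring

theorem finalState_estimationGates (hψ : ∑ b, ‖ψ b‖ ^ 2 = 1) {a : ℝ}
    (ha : a = ∑ b, ‖ψ b‖ ^ 2 * (φ (outcome q b) : ℝ)) :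
    Gate.finalState ψ ((0, 0) : Fin 2 × Fin (s + 1)) (estimationGates q φ s) =
      flagState (fun b z => fourierAmp s (fun y => (iterateCoeff a y).1) z * cosAmp q φ b * ψ b)
        (fun b z => fourierAmp s (fun y => (iterateCoeff a y).2) z * sinAmp q φ b * ψ b) := by
  have hsq : (1 / (√(s + 1 : ℝ) : ℂ)) * (1 / (√(s + 1 : ℝ) : ℂ)) = 1 / ((s + 1 : ℕ) : ℂ) := by
    rw [div_mul_div_comm, ← Complex.ofReal_mul, Real.mul_self_sqrt (by positivity)]
    push_cast
    ring
  have key : ∀ (g : ℕ → ℝ) (z : Fin (s + 1)) (e : ℂ),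
      ∑ y : Fin (s + 1), star ((fourier s).1 y z) *
        (1 / (√(s + 1 : ℝ) : ℂ) * (g (min s y) : ℂ) * e) = fourierAmp s g z * e := by
    intro g z e
    rw [fourierAmp, ← Fin.sum_univ_eq_sum_range (fun y => Complex.exp
      (-(2 * Real.pi * Complex.I * y * z / (s + 1 : ℕ))) * (g y : ℂ)), Finset.mul_sum,
      Finset.sum_mul]
    refine Finset.sum_congr rfl fun y _ => ?_
    -- The register holds `y ≤ s`, so after `s` controlled steps branch `y` has been iterated
    -- exactly `y` times.
    rw [min_eq_right (Nat.lt_succ_iff.mp y.2), ← hsq]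
    simp only [fourier, Matrix.of_apply, Complex.star_def, map_mul, map_div₀, map_one,
      Complex.conj_ofReal, ← Complex.exp_conj, Complex.conj_I, map_natCast, map_ofNat]
    rw [show (2 * Real.pi * -Complex.I * (y : ℕ) * (z : ℕ) / (s + 1 : ℕ) : ℂ) =
      -(2 * Real.pi * Complex.I * (y : ℕ) * (z : ℕ) / (s + 1 : ℕ)) by ring]
    ring
  rw [foldl_estimationGates q φ hψ ha, iterateState, gateF_inv_mulVec]
  congr 1 <;> funext b z
  · simp only [mul_assoc _ (cosAmp q φ b) (ψ b)]
    exact key (fun y => (iterateCoeff a y).1) z _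
  · simp only [mul_assoc _ (sinAmp q φ b) (ψ b)]
    exact key (fun y => (iterateCoeff a y).2) z _

/-- The distribution of the outcome of the Fourier register. -/
theorem sum_norm_sq_finalState_estimationGates (hψ : ∑ b, ‖ψ b‖ ^ 2 = 1) {θ : ℝ}
    (hθ : Real.sin θ ^ 2 = ∑ b, ‖ψ b‖ ^ 2 * (φ (outcome q b) : ℝ)) (w : Fin (s + 1) → ℝ) :
    ∑ o, ‖Gate.finalState ψ ((0, 0) : Fin 2 × Fin (s + 1)) (estimationGates q φ s) o‖ ^ 2 *
        w o.2.2 =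
      ∑ z : Fin (s + 1), (‖fourierAmp s (fun y => Real.cos ((2 * y + 1) * θ)) z‖ ^ 2 +
        ‖fourierAmp s (fun y => Real.sin ((2 * y + 1) * θ)) z‖ ^ 2) * w z := by
  have hc : ∀ b, ‖cosAmp q φ b‖ ^ 2 = 1 - (φ (outcome q b) : ℝ) := by
    intro b
    rw [cosAmp, Complex.norm_real, Real.norm_eq_abs, sq_abs,
      Real.sq_sqrt (by linarith [(φ (outcome q b)).2.2])]
  have hs : ∀ b, ‖sinAmp q φ b‖ ^ 2 = (φ (outcome q b) : ℝ) := by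
    intro b
    rw [sinAmp, Complex.norm_real, Real.norm_eq_abs, sq_abs, Real.sq_sqrt (φ (outcome q b)).2.1]
  have h1 : ∑ b, ‖ψ b‖ ^ 2 * (1 - (φ (outcome q b) : ℝ)) = Real.cos θ ^ 2 := by
    simp only [mul_sub, mul_one, Finset.sum_sub_distrib, hψ, ← hθ]
    linarith [Real.sin_sq_add_cos_sq θ]
  rw [finalState_estimationGates q φ hψ hθ]
  simp only [flagState, Fintype.sum_prod_type, Fin.sum_univ_two]
  simp only [if_true, one_ne_zero, if_false, norm_mul, mul_pow, hc, hs]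
  rw [Finset.sum_add_distrib, Finset.sum_comm, Finset.sum_comm (f := fun b z => _ * _ * _ * w z),
    ← Finset.sum_add_distrib]
  refine Finset.sum_congr rfl fun z _ => ?_
  rw [← Finset.sum_mul, ← Finset.sum_mul, ← add_mul]
  congr 2
  · simp only [← (cos_mul_iterateCoeff θ _).1, fourierAmp_const_mul, norm_mul, mul_pow,
      Complex.norm_real, Real.norm_eq_abs, sq_abs, ← h1, Finset.sum_mul]
    exact Finset.sum_congr rfl fun b _ => by ring
  · simp only [← (cos_mul_iterateCoeff θ _).2, fourierAmp_const_mul, norm_mul, mul_pow,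
      Complex.norm_real, Real.norm_eq_abs, sq_abs, hθ, Finset.sum_mul]
    exact Finset.sum_congr rfl fun b _ => by ring

end EstimationState
/-! ### The accuracy of amplitude estimation -/

/-- By Euler's formula the cosine and sine amplitudes are the sum and the difference of the kernels
at `θ` and `-θ`, up to phases and the factors `2` and `2i`. The parallelogram law removes the
interference between the two. -/
theorem norm_sq_fourierAmp_cos_add_sin (s : ℕ) (θ : ℝ) (z : ℕ) :
    ‖fourierAmp s (fun y => Real.cos ((2 * y + 1) * θ)) z‖ ^ 2 +
        ‖fourierAmp s (fun y => Real.sin ((2 * y + 1) * θ)) z‖ ^ 2 =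
      (‖(1 / (s + 1 : ℕ) : ℂ) * ∑ y ∈ Finset.range (s + 1),
        Complex.exp (2 * ((θ - Real.pi * z / (s + 1 : ℕ) : ℝ) : ℂ) * Complex.I) ^ y‖ ^ 2 +
      ‖(1 / (s + 1 : ℕ) : ℂ) * ∑ y ∈ Finset.range (s + 1),
        Complex.exp (2 * ((-θ - Real.pi * z / (s + 1 : ℕ) : ℝ) : ℂ) * Complex.I) ^ y‖ ^ 2) / 2 := by
  set G : ℝ → ℂ := fun θ => (1 / (s + 1 : ℕ) : ℂ) * ∑ y ∈ Finset.range (s + 1),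
        Complex.exp (2 * ((θ - Real.pi * z / (s + 1 : ℕ) : ℝ) : ℂ) * Complex.I) ^ y with hG
  have hE : ∀ θ : ℝ, Complex.exp (θ * Complex.I) * G θ = 1 / ((s + 1 : ℕ) : ℂ) *
      ∑ y ∈ Finset.range (s + 1), Complex.exp (-(2 * Real.pi * Complex.I * y * z / (s + 1 : ℕ))) *
        Complex.exp (((2 * y + 1) * θ : ℝ) * Complex.I) := by
    intro θ
    rw [hG, mul_left_comm, Finset.mul_sum]
    congr 1
    refine Finset.sum_congr rfl fun y _ => ?_
    rw [← Complex.exp_nat_mul, ← Complex.exp_add, ← Complex.exp_add]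
    congr 1
    push_cast
    ring
  have hn : ∀ θ : ℝ, ‖Complex.exp (θ * Complex.I) * G θ‖ = ‖G θ‖ := by
    intro θ
    rw [norm_mul, Complex.norm_exp_ofReal_mul_I, one_mul]
  have hneg : ∀ y : ℕ, (((2 * y + 1) * -θ : ℝ) : ℂ) = -(((2 * y + 1) * θ : ℝ) : ℂ) := by
    intro y
    push_cast
    ring
  have hC : Complex.exp (θ * Complex.I) * G θ + Complex.exp ((-θ : ℝ) * Complex.I) * G (-θ) =
      2 * fourierAmp s (fun y => Real.cos ((2 * y + 1) * θ)) z := by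
    rw [hE, hE, ← mul_add, ← Finset.sum_add_distrib, fourierAmp, mul_left_comm _ (1 / ((s + 1 : ℕ) : ℂ))]
    congr 1
    rw [Finset.mul_sum]
    refine Finset.sum_congr rfl fun y _ => ?_
    rw [Complex.ofReal_cos, ← mul_add, hneg, mul_left_comm, Complex.two_cos]
  have hS : Complex.exp (θ * Complex.I) * G θ - Complex.exp ((-θ : ℝ) * Complex.I) * G (-θ) =
      2 * Complex.I * fourierAmp s (fun y => Real.sin ((2 * y + 1) * θ)) z := by
    rw [hE, hE, ← mul_sub, ← Finset.sum_sub_distrib, fourierAmp, mul_left_comm _ (1 / ((s + 1 : ℕ) : ℂ))]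
    congr 1
    rw [Finset.mul_sum]
    refine Finset.sum_congr rfl fun y _ => ?_
    rw [Complex.ofReal_sin, ← mul_sub, hneg, mul_left_comm]
    congr 1
    have := Complex.two_sin (((2 * y + 1) * θ : ℝ) : ℂ)
    linear_combination (-Complex.I) * this + (Complex.exp (((2 * y + 1) * θ : ℝ) * Complex.I) -
      Complex.exp (-(((2 * y + 1) * θ : ℝ) : ℂ) * Complex.I)) * Complex.I_sq
  have hp := parallelogram_law_with_norm ℝ (Complex.exp (θ * Complex.I) * G θ)
    (Complex.exp ((-θ : ℝ) * Complex.I) * G (-θ))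
  rw [hC, hS, hn, hn, norm_mul, norm_mul, norm_mul, Complex.norm_I, Complex.norm_ofNat] at hp
  linarith

/-- The error of amplitude estimation with `t` iterations. -/
def estimationError (a : ℝ) (t : ℕ) : ℝ := 10 * Real.pi * √a / t + 25 * Real.pi ^ 2 / (t : ℝ) ^ 2

/-- The phases `θ` and `-θ` have the same `sin² = a`, so an outcome with a bad estimate lies in the
tail of both kernels. The failure probability is therefore at most the average of two tails, each at
most `1/4`. -/
theorem prob_amplitudeEstimation_le {n k : ℕ} {ψ : Bits n → ℂ} (q : Fin k ↪ Fin n)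
    (φ : Bits k → unitInterval) (hψ : ∑ b, ‖ψ b‖ ^ 2 = 1) {a : ℝ}
    (ha : a = ∑ b, ‖ψ b‖ ^ 2 * (φ (outcome q b) : ℝ)) {t : ℕ} (ht : 0 < t) :
    (amplitudeEstimation q φ t).prob ψ {x | |x - a| ≤ estimationError a t}ᶜ ≤ 1 / 4 := by
  obtain ⟨s, rfl⟩ := Nat.exists_eq_add_of_le' ht
  have ha0 : 0 ≤ a := ha ▸ Finset.sum_nonneg fun b _ =>
    mul_nonneg (by positivity) (φ (outcome q b)).2.1
  have ha1 : a ≤ 1 := by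
    rw [ha, ← hψ]
    exact Finset.sum_le_sum fun b _ => mul_le_of_le_one_right (by positivity) (φ (outcome q b)).2.2
  set θ := Real.arcsin √a with hθ
  have hsin : Real.sin θ = √a :=
    Real.sin_arcsin (by linarith [Real.sqrt_nonneg a]) (Real.sqrt_le_one.mpr ha1)
  have hsin2 : Real.sin θ ^ 2 = a := by rw [hsin, Real.sq_sqrt ha0]
  have h1 : -(Real.pi / 2) ≤ θ := Real.neg_pi_div_two_le_arcsin _
  have h2 : θ ≤ Real.pi / 2 := Real.arcsin_le_pi_div_two _
  have hp := sum_norm_sq_geom_sum_tail_le h1 h2 ht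
  have hm := sum_norm_sq_geom_sum_tail_le (θ := -θ) (by linarith) (by linarith) ht
  set E : Set ℝ := {x | |x - a| ≤ estimationError a (s + 1)}ᶜ with hE
  have hbad : ∀ (z : ℕ) (θ' : ℝ), Real.sin θ' ^ 2 = a →
      Real.sin (Real.pi * z / (s + 1 : ℕ)) ^ 2 ∈ E →
      5 * Real.pi / (s + 1 : ℕ) < |Real.sin (Real.pi * z / (s + 1 : ℕ) - θ')| := by
    intro z θ' h hz
    by_contra hle
    refine hz ?_
    -- With phase error `r = 5π/t` and `|sin θ'| = √a`, the bound `2√a r + r²` is exactly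
    -- `estimationError`.
    have := abs_sin_sq_sub_sin_sq_le (not_lt.mp hle)
    rw [h] at this
    refine this.trans (le_of_eq ?_)
    rw [← Real.sqrt_sq_eq_abs, h, estimationError]
    ring
  have key := sum_norm_sq_finalState_estimationGates q φ (s := s) hψ (hsin2.trans ha) fun z =>
    E.indicator (fun _ => 1) (Real.sin (Real.pi * (z : ℕ) / (s + 1 : ℕ)) ^ 2)
  calc (amplitudeEstimation q φ (s + 1)).prob ψ E
      = ∑ z : Fin (s + 1), (‖fourierAmp s (fun y => Real.cos ((2 * y + 1) * θ)) z‖ ^ 2 +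
        ‖fourierAmp s (fun y => Real.sin ((2 * y + 1) * θ)) z‖ ^ 2) *
          E.indicator (fun _ => 1) (Real.sin (Real.pi * (z : ℕ) / (s + 1 : ℕ)) ^ 2) := key
    _ = ∑ z ∈ Finset.range (s + 1), (‖fourierAmp s (fun y => Real.cos ((2 * y + 1) * θ)) z‖ ^ 2 +
        ‖fourierAmp s (fun y => Real.sin ((2 * y + 1) * θ)) z‖ ^ 2) *
          E.indicator (fun _ => 1) (Real.sin (Real.pi * (z : ℕ) / (s + 1 : ℕ)) ^ 2) :=
        Fin.sum_univ_eq_sum_range (fun z => (‖fourierAmp s (fun y =>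
          Real.cos ((2 * y + 1) * θ)) z‖ ^ 2 +
          ‖fourierAmp s (fun y => Real.sin ((2 * y + 1) * θ)) z‖ ^ 2) *
          E.indicator (fun _ => 1) (Real.sin (Real.pi * (z : ℕ) / (s + 1 : ℕ)) ^ 2)) _
    _ ≤ (1 / 4 + 1 / 4) / 2 := by
        refine le_trans ?_ (div_le_div_of_nonneg_right (add_le_add hp hm) zero_le_two)
        rw [← Finset.sum_add_distrib, Finset.sum_div]
        refine Finset.sum_le_sum fun z _ => ?_
        rw [norm_sq_fourierAmp_cos_add_sin]
        by_cases hz : Real.sin (Real.pi * z / (s + 1 : ℕ)) ^ 2 ∈ E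
        · rw [if_pos (hbad z θ hsin2 hz), if_pos (hbad z (-θ) (by rw [Real.sin_neg, neg_sq, hsin2]) hz),
            Set.indicator_of_mem hz, mul_one]
        · rw [Set.indicator_of_notMem hz, mul_zero]
          positivity
    _ = 1 / 4 := by norm_num

theorem always_amplitudeEstimation {n k : ℕ} (q : Fin k ↪ Fin n) (φ : Bits k → unitInterval)
    (t : ℕ) : (amplitudeEstimation q φ t).Always (· ∈ Set.Icc (0 : ℝ) 1) :=
  fun _ => ⟨sq_nonneg _, Real.sin_sq_le_one _⟩

theorem ordConnected_abs_sub_le (a e : ℝ) : {x : ℝ | |x - a| ≤ e}.OrdConnected := by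
  have : {x : ℝ | |x - a| ≤ e} = Metric.closedBall a e := by
    ext x
    simp [Real.dist_eq]
  rw [this, Real.closedBall_eq_Icc]
  exact Set.ordConnected_Icc

theorem prob_boundedMean_le {n k : ℕ} {ψ : Bits n → ℂ} (q : Fin k ↪ Fin n)
    (φ : Bits k → unitInterval) (hψ : ∑ b, ‖ψ b‖ ^ 2 = 1) {a : ℝ}
    (ha : a = ∑ b, ‖ψ b‖ ^ 2 * (φ (outcome q b) : ℝ)) {t : ℕ} (ht : 0 < t) {δ : ℝ} (hδ : 0 < δ) :
    (boundedMean 8 q φ t δ).prob ψ {x | |x - a| ≤ estimationError a t}ᶜ ≤ δ :=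
  prob_powering_le hψ hδ (ordConnected_abs_sub_le _ _) (prob_amplitudeEstimation_le q φ hψ ha ht)

theorem always_boundedMean {n k : ℕ} (c : ℝ) (q : Fin k ↪ Fin n) (φ : Bits k → unitInterval)
    (t : ℕ) (δ : ℝ) : (boundedMean c q φ t δ).Always (· ∈ Set.Icc (0 : ℝ) 1) :=
  always_powering ⟨le_rfl, zero_le_one⟩ (always_amplitudeEstimation q φ t)

theorem copies_amplitudeEstimation {n k : ℕ} (q : Fin k ↪ Fin n) (φ : Bits k → unitInterval)
    (t : ℕ) : (amplitudeEstimation q φ t).copies = 1 := by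
  simp [amplitudeEstimation, Program.copies]

theorem uses_amplitudeEstimation {n k : ℕ} (q : Fin k ↪ Fin n) (φ : Bits k → unitInterval)
    (t : ℕ) : (amplitudeEstimation q φ t).uses = t - 1 := by
  have h : ∀ s : ℕ, (((List.range s).flatMap fun j => iterate q φ (t - 1) (j + 1)).map
      Gate.uses).sum = s := by
    intro s
    induction s with
    | zero => rfl
    | succ s ih =>
      rw [List.range_succ, List.flatMap_append, List.map_append, List.sum_append, ih]
      simp [iterate, Gate.uses]
  simp [amplitudeEstimation, Program.uses, estimationGates, h, Gate.uses]

theorem copies_boundedMean_le {n k : ℕ} (c : ℝ) (q : Fin k ↪ Fin n) (φ : Bits k → unitInterval)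
    (t : ℕ) (δ : ℝ) : (boundedMean c q φ t δ).copies ≤ repetitions c δ :=
  (copies_powering_le c δ _).trans_eq (by rw [copies_amplitudeEstimation, mul_one])

theorem uses_boundedMean_le {n k : ℕ} (c : ℝ) (q : Fin k ↪ Fin n) (φ : Bits k → unitInterval)
    (t : ℕ) (δ : ℝ) : (boundedMean c q φ t δ).uses ≤ repetitions c δ * (t - 1) :=
  (uses_powering_le c δ _).trans_eq (by rw [uses_amplitudeEstimation])

/-! ### The accuracy of the estimation algorithms -/

theorem abs_sum_sub_sum_le_of_forall₂ {ι : Type} {c e : ι → ℝ} {is : List ι} {l : List ℝ}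
    (h : List.Forall₂ (fun i x => |x - c i| ≤ e i) is l) :
    |l.sum - (is.map c).sum| ≤ (is.map e).sum := by
  induction h with
  | nil => simp
  | @cons i x is l hx _ ih =>
    simp only [List.sum_cons, List.map_cons]
    rw [add_sub_add_comm]
    exact (abs_add_le _ _).trans (add_le_add hx ih)

theorem sum_map_range (f : ℕ → ℝ) (K : ℕ) :
    ((List.range K).map f).sum = ∑ i ∈ Finset.range K, f i := rfl

theorem sum_dyadic_indicator {x : ℝ} (hx : 0 ≤ x) (v : ℝ) (K : ℕ) :
    (if 0 ≤ x ∧ x < 1 then v else 0) +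
      ∑ i ∈ Finset.range K, (if (2 : ℝ) ^ i ≤ x ∧ x < 2 ^ (i + 1) then v else 0) =
        if x < 2 ^ K then v else 0 := by
  induction K with
  | zero => simp [hx]
  | succ K ih =>
    rw [Finset.sum_range_succ, ← add_assoc, ih]
    have hpow : (2 : ℝ) ^ K ≤ 2 ^ (K + 1) := pow_le_pow_right₀ one_le_two (Nat.le_succ K)
    rcases lt_or_ge x (2 ^ K) with h | h
    · rw [if_pos h, if_neg (fun h' => absurd h'.1 (not_le.mpr h)), if_pos (h.trans_le hpow), add_zero]
    · rw [if_neg (not_lt.mpr h), zero_add]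
      simp [h]

/-! ### Dyadic decomposition of a nonnegative random variable -/

section DyadicMean

variable {Ω : Type*} [Fintype Ω] {p X : Ω → ℝ}

/-- The mean of the part of `X` in `[2ⁱ, 2ⁱ⁺¹)`, divided by `2ⁱ⁺¹`. -/
def dyadicMean (p X : Ω → ℝ) (i : ℕ) : ℝ :=
  ∑ b, p b * (if (2 : ℝ) ^ i ≤ X b ∧ X b < 2 ^ (i + 1) then X b / 2 ^ (i + 1) else 0)

/-- The mean of the part of `X` in `[0, 1)`. -/
def unitMean (p X : Ω → ℝ) : ℝ := ∑ b, p b * (if 0 ≤ X b ∧ X b < 1 then X b / 1 else 0)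

theorem dyadicMean_nonneg (hp : ∀ b, 0 ≤ p b) (i : ℕ) : 0 ≤ dyadicMean p X i := by
  refine Finset.sum_nonneg fun b _ => mul_nonneg (hp b) ?_
  split_ifs with h
  · exact div_nonneg ((by positivity : (0 : ℝ) ≤ 2 ^ i).trans h.1) (by positivity)
  · exact le_rfl

theorem unitMean_le_one (hp : ∀ b, 0 ≤ p b) (hp1 : ∑ b, p b = 1) : unitMean p X ≤ 1 := by
  refine (Finset.sum_le_sum fun b _ => mul_le_of_le_one_right (hp b) ?_).trans_eq hp1
  split_ifs with h
  · rw [div_one]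
    exact h.2.le
  · exact zero_le_one

/-- The levels partition `[0, 2^K)`, so only the values `X ≥ 2^K` are lost, and there `X ≤ X²/2^K`.
-/
theorem abs_unitMean_add_sum_sub_le (hp : ∀ b, 0 ≤ p b) (hX : ∀ b, 0 < p b → 0 ≤ X b) (K : ℕ) :
    |unitMean p X + ∑ i ∈ Finset.range K, 2 ^ (i + 1) * dyadicMean p X i - ∑ b, p b * X b| ≤
      (∑ b, p b * X b ^ 2) / 2 ^ K := by
  have hK : (0 : ℝ) < 2 ^ K := by positivity
  have e : unitMean p X + ∑ i ∈ Finset.range K, 2 ^ (i + 1) * dyadicMean p X i =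
      ∑ b, p b * (if X b < 2 ^ K then X b else 0) := by
    simp only [unitMean, dyadicMean, Finset.mul_sum]
    rw [Finset.sum_comm, ← Finset.sum_add_distrib]
    refine Finset.sum_congr rfl fun b _ => ?_
    rcases (hp b).eq_or_lt with h0 | h0
    · simp [← h0]
    · rw [← sum_dyadic_indicator (hX b h0) (X b) K, mul_add, Finset.mul_sum]
      congr 1
      · rw [div_one]
      · refine Finset.sum_congr rfl fun i _ => ?_
        split_ifs
        · field_simp
        · ring
  rw [e, ← Finset.sum_sub_distrib, Finset.sum_div]
  refine (Finset.abs_sum_le_sum_abs _ _).trans (Finset.sum_le_sum fun b _ => ?_)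
  rw [← mul_sub, abs_mul, abs_of_nonneg (hp b), mul_div_assoc]
  refine mul_le_mul_of_nonneg_left ?_ (hp b)
  split_ifs with h
  · rw [sub_self, abs_zero]
    positivity
  · rw [not_lt] at h
    rw [zero_sub, abs_neg, abs_of_nonneg (hK.le.trans h), le_div_iff₀ hK, sq]
    exact mul_le_mul_of_nonneg_left h (hK.le.trans h)

/-- Cauchy–Schwarz over the `K` levels. The square of the `i`-th term is the mean of `2^(i+1) X` on
its level, where `2^(i+1) ≤ 2X`; hence all squares together are at most twice the second moment. -/
theorem sum_sqrt_dyadicMean_le (hp : ∀ b, 0 ≤ p b) (hX : ∀ b, 0 < p b → 0 ≤ X b) (K : ℕ) :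
    ∑ i ∈ Finset.range K, 2 ^ (i + 1) * √(dyadicMean p X i) ≤
      √(2 * K * ∑ b, p b * X b ^ 2) := by
  refine Real.le_sqrt_of_sq_le ?_
  refine (sq_sum_le_card_mul_sum_sq).trans ?_
  rw [Finset.card_range, mul_comm (2 : ℝ), mul_assoc]
  refine mul_le_mul_of_nonneg_left ?_ (Nat.cast_nonneg K)
  calc ∑ i ∈ Finset.range K, (2 ^ (i + 1) * √(dyadicMean p X i)) ^ 2
      = ∑ i ∈ Finset.range K, ∑ b, p b * (if (2 : ℝ) ^ i ≤ X b ∧ X b < 2 ^ (i + 1) then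
          2 ^ (i + 1) * X b else 0) := by
        refine Finset.sum_congr rfl fun i _ => ?_
        rw [mul_pow, Real.sq_sqrt (dyadicMean_nonneg hp i), dyadicMean, Finset.mul_sum]
        refine Finset.sum_congr rfl fun b _ => ?_
        split_ifs
        · field_simp
        · ring
    _ ≤ ∑ i ∈ Finset.range K, ∑ b, p b * (if (2 : ℝ) ^ i ≤ X b ∧ X b < 2 ^ (i + 1) then
          2 * X b ^ 2 else 0) := by
        refine Finset.sum_le_sum fun i _ => Finset.sum_le_sum fun b _ =>
          mul_le_mul_of_nonneg_left ?_ (hp b)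
        split_ifs with h
        · have : (0 : ℝ) < 2 ^ i := by positivity
          rw [pow_succ]
          nlinarith [h.1]
        · exact le_rfl
    _ = ∑ b, p b * ∑ i ∈ Finset.range K, (if (2 : ℝ) ^ i ≤ X b ∧ X b < 2 ^ (i + 1) then
          2 * X b ^ 2 else 0) := by
        rw [Finset.sum_comm]
        exact Finset.sum_congr rfl fun b _ => (Finset.mul_sum _ _ _).symm
    _ ≤ ∑ b, p b * (2 * X b ^ 2) := by
        refine Finset.sum_le_sum fun b _ => ?_
        rcases (hp b).eq_or_lt with h0 | h0
        · simp [← h0]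
        · refine mul_le_mul_of_nonneg_left ?_ (hp b)
          have h := sum_dyadic_indicator (hX b h0) (2 * X b ^ 2) K
          have h1 : 0 ≤ if 0 ≤ X b ∧ X b < 1 then 2 * X b ^ 2 else 0 := by positivity
          have h2 : (if X b < 2 ^ K then 2 * X b ^ 2 else 0) ≤ 2 * X b ^ 2 := by
            split_ifs
            · exact le_rfl
            · positivity
          linarith
    _ = 2 * ∑ b, p b * X b ^ 2 := by
        rw [Finset.mul_sum]
        exact Finset.sum_congr rfl fun b _ => by ring

end DyadicMean

theorem estimationError_le {a t : ℝ} {N : ℕ} (ht : 0 < t) (hN : t ≤ N) :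
    estimationError a N ≤ 32 * √a / t + 250 / t ^ 2 := by
  have h1 := Real.pi_lt_d2
  have h2 := Real.pi_pos
  rw [estimationError]
  have h3 : 10 * Real.pi ≤ 32 := by linarith
  have h4 : 25 * Real.pi ^ 2 ≤ 250 := by nlinarith
  gcongr

/-- With `L = log₂(1/η) ≥ 1` one has `K ≤ 2L` and `1/η ≤ 2^K ≤ 2/η`. The constant `1282` is `282 +
1000`: `32 + 250` from the bounded part, and `250 · 2 · 2` from the quadratic errors of the levels,
whose weights `2^(i+1)` sum to less than `2 · 2^K`. -/
theorem sum_error_le {Ω : Type*} [Fintype Ω] {p X : Ω → ℝ} (hp : ∀ b, 0 ≤ p b)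
    (hp1 : ∑ b, p b = 1) (hX : ∀ b, 0 < p b → 0 ≤ X b) {D η : ℝ} (hD : 1 ≤ D) (hη : 0 < η)
    (hη2 : η < 1 / 2) {K t₀ : ℕ} (hK : K = ⌈Real.logb 2 (1 / η)⌉₊)
    (ht₀ : t₀ = ⌈D * √(Real.logb 2 (1 / η)) / η⌉₊) :
    estimationError (unitMean p X) t₀ +
      ∑ i ∈ Finset.range K, 2 ^ (i + 1) * estimationError (dyadicMean p X i) t₀ +
      (∑ b, p b * X b ^ 2) / 2 ^ K ≤
    η * ((∑ b, p b * X b ^ 2) + (64 * √(∑ b, p b * X b ^ 2) + 1282) / D) := by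
  set S := ∑ b, p b * X b ^ 2 with hS
  have hS0 : 0 ≤ S := Finset.sum_nonneg fun b _ => mul_nonneg (hp b) (sq_nonneg _)
  set L := Real.logb 2 (1 / η) with hL
  have hD0 : 0 < D := by linarith
  have hpowL : (2 : ℝ) ^ L = 1 / η := Real.rpow_logb two_pos (by norm_num) (by positivity)
  have hL1 : 1 ≤ L := by
    rw [hL, Real.le_logb_iff_rpow_le one_lt_two (by positivity), Real.rpow_one,
      le_div_iff₀ hη]
    linarith
  have hKL : L ≤ K := hK ▸ Nat.le_ceil L
  have hKL' : (K : ℝ) < L + 1 := hK ▸ Nat.ceil_lt_add_one (by linarith)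
  have hpow1 : 1 / η ≤ 2 ^ K := by
    rw [← hpowL, ← Real.rpow_natCast]
    exact Real.rpow_le_rpow_of_exponent_le one_le_two hKL
  have hpow2 : 2 ^ K ≤ 2 / η := by
    have : (2 : ℝ) ^ (K : ℝ) ≤ 2 ^ (L + 1) :=
      Real.rpow_le_rpow_of_exponent_le one_le_two hKL'.le
    rw [Real.rpow_natCast, Real.rpow_add two_pos, hpowL, Real.rpow_one] at this
    exact this.trans_eq (by ring)
  set t := D * √L / η with ht
  have hsL : 1 ≤ √L := Real.one_le_sqrt.mpr hL1
  have htpos : 0 < t := by positivity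
  have htt : t ≤ t₀ := ht₀ ▸ Nat.le_ceil t
  have htD : D / η ≤ t := by
    rw [ht]
    gcongr
    nlinarith
  have hit : 1 / t ≤ η / D := by
    rw [div_le_div_iff₀ htpos hD0, one_mul]
    rwa [div_le_iff₀' hη] at htD
  have hit0 : 0 < 1 / t := by positivity
  have hη0 : η / D ≤ 1 := by
    rw [div_le_one hD0]
    linarith
  have e0 : estimationError (unitMean p X) t₀ ≤ η * (282 / D) := by
    refine (estimationError_le htpos htt).trans ?_
    have h1 : √(unitMean p X) ≤ 1 := Real.sqrt_le_one.mpr (unitMean_le_one hp hp1)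
    calc 32 * √(unitMean p X) / t + 250 / t ^ 2
        = 32 * √(unitMean p X) * (1 / t) + 250 * ((1 / t) * (1 / t)) := by ring
      _ ≤ 32 * 1 * (η / D) + 250 * (1 * (η / D)) := by
        gcongr
        exact hit.trans hη0
      _ = _ := by ring
  have e1 : ∑ i ∈ Finset.range K, 2 ^ (i + 1) * estimationError (dyadicMean p X i) t₀ ≤
      32 * (√(2 * K * S)) / t + 250 * (2 * 2 ^ K) / t ^ 2 := by
    calc ∑ i ∈ Finset.range K, 2 ^ (i + 1) * estimationError (dyadicMean p X i) t₀
        ≤ ∑ i ∈ Finset.range K, 2 ^ (i + 1) *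
          (32 * √(dyadicMean p X i) / t + 250 / t ^ 2) := by
          gcongr with i _
          exact estimationError_le htpos htt
      _ = 32 * (∑ i ∈ Finset.range K, 2 ^ (i + 1) * √(dyadicMean p X i)) / t +
          250 * (2 * ∑ i ∈ Finset.range K, 2 ^ i) / t ^ 2 := by
          simp only [Finset.mul_sum, Finset.sum_div, ← Finset.sum_add_distrib]
          exact Finset.sum_congr rfl fun i _ => by ring
      _ ≤ _ := by
          gcongr
          · exact sum_sqrt_dyadicMean_le hp hX K
          · rw [geom_sum_eq (by norm_num)]
            norm_num
  have e2 : 32 * (√(2 * K * S)) / t ≤ η * (64 * √S / D) := by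
    have h1 : √(2 * K * S) ≤ 2 * √L * √S := by
      rw [Real.sqrt_le_left (by positivity), mul_pow, mul_pow, Real.sq_sqrt (by linarith),
        Real.sq_sqrt hS0]
      refine mul_le_mul_of_nonneg_right ?_ hS0
      linarith
    calc 32 * (√(2 * K * S)) / t ≤ 32 * (2 * √L * √S) / t := by gcongr
      _ = _ := by rw [ht]; field_simp; ring
  have e3 : 250 * (2 * 2 ^ K) / t ^ 2 ≤ η * (1000 / D) := by
    calc 250 * (2 * 2 ^ K) / t ^ 2 ≤ 250 * (2 * (2 / η)) / (D / η) ^ 2 := by gcongr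
      _ = η * (1000 / D) * (1 / D) := by field_simp; norm_num
      _ ≤ η * (1000 / D) * 1 := by
        gcongr
        exact (div_le_one hD0).mpr hD
      _ = _ := mul_one _
  have e4 : S / 2 ^ K ≤ η * S := by
    rw [div_le_iff₀ (by positivity)]
    rw [div_le_iff₀' hη] at hpow1
    nlinarith
  calc _ ≤ η * (282 / D) + (η * (64 * √S / D) + η * (1000 / D)) + η * S := by linarith
    _ = _ := by ring

/-! ### The `ℓ₂`-mean procedure -/

section L2Mean

variable {n k : ℕ} {ψ : Bits n → ℂ} (A : Readout n k)

theorem prob_l2Mean_le (hψ : ∑ b, ‖ψ b‖ ^ 2 = 1)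
    (hA : ∀ b, 0 < ‖ψ b‖ ^ 2 → 0 ≤ A.value (outcome A.qubits b)) {D η : ℝ} (hD : 1 ≤ D)
    (hη : 0 < η) (hη2 : η < 1 / 2) {M S : ℝ}
    (hM : M = ∑ b, ‖ψ b‖ ^ 2 * A.value (outcome A.qubits b))
    (hS : S = ∑ b, ‖ψ b‖ ^ 2 * A.value (outcome A.qubits b) ^ 2) :
    (l2Mean D 8 A η).prob ψ {x | |x - M| ≤ η * (S + (64 * √S + 1282) / D)}ᶜ ≤ 1 / 4 := by
  set p : Bits n → ℝ := fun b => ‖ψ b‖ ^ 2 with hp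
  set X : Bits n → ℝ := fun b => A.value (outcome A.qubits b) with hX
  have hp0 : ∀ b, 0 ≤ p b := fun b => by positivity
  set K : ℕ := ⌈Real.logb 2 (1 / η)⌉₊ with hK
  set t₀ : ℕ := ⌈D * √(Real.logb 2 (1 / η)) / η⌉₊ with ht₀
  have hlog : 0 < Real.logb 2 (1 / η) :=
    Real.logb_pos one_lt_two (by rw [lt_div_iff₀ hη]; linarith)
  have hKpos : 0 < K := Nat.ceil_pos.mpr hlog
  have htpos : 0 < t₀ := Nat.ceil_pos.mpr (by positivity)
  have herr := sum_error_le hp0 hψ hA hD hη hη2 hK ht₀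
  have hbias := abs_unitMean_add_sum_sub_le hp0 hA K
  rw [← hS] at herr
  rw [← hM, ← hS] at hbias
  have hK' : (0 : ℝ) < K := Nat.cast_pos.mpr hKpos
  have hfirst := prob_boundedMean_le (ψ := ψ) A.qubits (truncated A.value 0 1 le_rfl one_pos) hψ
    (a := unitMean p X) rfl htpos (δ := 1 / 10) (by norm_num)
  -- The bounded part and the `K` levels together fail with probability at most `1/10 + 1/10 ≤ 1/4`.
  refine (Program.prob_bind_le hψ (δ := K * (1 / (10 * K))) (by positivity) (fun μ₀ hμ₀ => ?_)
    (E := {x | |x - unitMean p X| ≤ estimationError (unitMean p X) t₀}ᶜ)).trans ?_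
  · rw [Program.prob_bind_pure]
    refine (Program.prob_mono ?_ _).trans ((Program.prob_sequence_map_le hψ (List.range K)
      (p := fun i x => |x - 2 ^ (i + 1) * dyadicMean p X i| ≤
        2 ^ (i + 1) * estimationError (dyadicMean p X i) t₀)
      (δ := 1 / (10 * K)) (by positivity) fun i _ => ?_).trans_eq (by rw [List.length_range]))
    · intro l hl hl'
      refine hl ?_
      have h1 := abs_sum_sub_sum_le_of_forall₂ hl'
      rw [sum_map_range, sum_map_range] at h1
      have h2 : |μ₀ - unitMean p X| ≤ estimationError (unitMean p X) t₀ := not_not.mp hμ₀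
      refine le_trans ?_ herr
      rw [abs_le] at h1 h2 hbias ⊢
      constructor <;> linarith [h1.1, h1.2, h2.1, h2.2, hbias.1, hbias.2]
    · rw [Program.prob_bind_pure]
      refine (Program.prob_mono ?_ _).trans (prob_boundedMean_le (ψ := ψ) A.qubits
        (truncated A.value (2 ^ i) (2 ^ (i + 1)) (by positivity) (by positivity)) hψ
        (a := dyadicMean p X i) rfl htpos (δ := 1 / (10 * K)) (by positivity))
      intro x hx hx'
      refine hx ?_
      rw [← mul_sub, abs_mul, abs_of_nonneg (by positivity)]
      exact mul_le_mul_of_nonneg_left hx' (by positivity)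
  · have : (K : ℝ) * (1 / (10 * K)) = 1 / 10 := by field_simp
    rw [this]
    linarith

/-- For such coarse accuracy `K ≤ 1`, so at most the values `μ₀ ≤ 1` and `2μ₁ ≤ 2` are added. It
replaces `prob_l2Mean_le`, which requires `η < 1/2`. -/
theorem always_l2Mean (D c : ℝ) {η : ℝ} (hη2 : 1 / 2 ≤ η) :
    (l2Mean D c A η).Always (· ∈ Set.Icc (0 : ℝ) 3) := by
  set K : ℕ := ⌈Real.logb 2 (1 / η)⌉₊ with hK
  have hη : 0 < η := by linarith
  have hK1 : K ≤ 1 := by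
    rw [hK, Nat.ceil_le, Nat.cast_one, Real.logb_le_iff_le_rpow one_lt_two (by positivity),
      Real.rpow_one, div_le_iff₀ hη]
    linarith
  refine (always_boundedMean c _ _ _ _).bind fun μ₀ hμ₀ => ?_
  refine (Program.always_sequence_map (List.range K)
    -- The interval `[0, 2^(i+1)]` is written with its centre and radius so that
    -- `abs_sum_sub_sum_le_of_forall₂` applies.
    (p := fun i x => |x - 2 ^ i| ≤ 2 ^ i) fun i _ => ?_).bind fun l hl => ?_
  · refine (always_boundedMean c _ _ _ _).bind fun μ hμ => ?_
    have hi : (0 : ℝ) < 2 ^ i := by positivity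
    change |2 ^ (i + 1) * μ - 2 ^ i| ≤ 2 ^ i
    rw [abs_le, pow_succ]
    constructor <;> nlinarith [hμ.1, hμ.2]
  · have h := abs_sum_sub_sum_le_of_forall₂ hl
    rw [sum_map_range, geom_sum_eq (by norm_num), abs_le] at h
    have h2 : (2 : ℝ) ^ K ≤ 2 ^ 1 := pow_le_pow_right₀ one_le_two hK1
    change μ₀ + l.sum ∈ Set.Icc (0 : ℝ) 3
    norm_num at h h2
    exact ⟨by linarith [hμ₀.1, h.1], by linarith [hμ₀.2, h.2]⟩

end L2Mean

/-! ### Relative accuracy of Algorithm 4 -/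

section RelativeMean

variable {n k : ℕ}

theorem QuantumAlgorithm.sum_norm_sq_state (A : QuantumAlgorithm n k) :
    ∑ b, ‖A.state b‖ ^ 2 = 1 := by
  have h := sum_norm_sq_mulVec_unitary A.unitary.2 (Pi.single 0 1)
  rw [Matrix.mulVec_single_one] at h
  refine h.trans ?_
  rw [Finset.sum_eq_single 0] <;> simp +contextual

theorem QuantumAlgorithm.sum_outcomeProb_mul (A : QuantumAlgorithm n k) (f : Bits k → ℝ) :
    ∑ x, A.outcomeProb x * f x = ∑ b, ‖A.state b‖ ^ 2 * f (outcome A.qubits b) := by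
  simp only [outcomeProb, Finset.sum_mul]
  rw [Finset.sum_comm]
  refine Finset.sum_congr rfl fun b _ => ?_
  simp [ite_mul]

theorem QuantumAlgorithm.outcomeProb_pos (A : QuantumAlgorithm n k) {b : Bits n}
    (h : 0 < ‖A.state b‖ ^ 2) : 0 < A.outcomeProb (outcome A.qubits b) := by
  refine Finset.sum_pos' (fun c _ => by positivity) ⟨b, Finset.mem_univ b, ?_⟩
  rwa [if_pos rfl]

theorem expect_sample (ψ : Bits n → ℂ) (A : Readout n k) (f : ℝ → ℝ) :
    (sample A).expect ψ f = ∑ b, ‖ψ b‖ ^ 2 * f (A.value (outcome A.qubits b)) := by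
  simp [sample, Program.expect, Gate.finalState, Fintype.sum_prod_type]

theorem prob_relativeMean_le (A : QuantumAlgorithm n k) {D B ε : ℝ} (hD : 1500 ≤ D) (hB : 1 ≤ B)
    (hε : 0 < ε) (hA : ∀ x, 0 < A.outcomeProb x → 0 ≤ A.value x) (hμ : 0 < A.mean)
    (hV : A.variance / A.mean ^ 2 ≤ B) :
    (relativeMean D 8 A.toReadout B ε).prob A.state {x | ε * A.mean ≤ |x - A.mean|} ≤ 1 / 4 := by
  have hψ := A.sum_norm_sq_state
  set μ := A.mean with hμdef
  set X : Bits n → ℝ := fun b => A.value (outcome A.qubits b) with hX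
  have hmean : μ = ∑ b, ‖A.state b‖ ^ 2 * X b := A.sum_outcomeProb_mul A.value
  have hvar : A.variance = ∑ b, ‖A.state b‖ ^ 2 * (X b - μ) ^ 2 :=
    A.sum_outcomeProb_mul fun x => (A.value x - μ) ^ 2
  rw [div_le_iff₀ (by positivity)] at hV
  have hsq : ∑ b, ‖A.state b‖ ^ 2 * X b ^ 2 ≤ (B + 1) * μ ^ 2 := by
    have : A.variance = ∑ b, ‖A.state b‖ ^ 2 * X b ^ 2 - μ ^ 2 := by
      have e : ∀ b, ‖A.state b‖ ^ 2 * (X b - μ) ^ 2 = ‖A.state b‖ ^ 2 * X b ^ 2 -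
          2 * μ * (‖A.state b‖ ^ 2 * X b) + μ ^ 2 * ‖A.state b‖ ^ 2 := fun b => by ring
      rw [hvar]
      simp only [e, Finset.sum_add_distrib, Finset.sum_sub_distrib, ← Finset.mul_sum, hψ, ← hmean]
      ring
    linarith
  have hsB : 1 ≤ √B := Real.one_le_sqrt.mpr hB
  have hsB2 : √B ^ 2 = B := Real.sq_sqrt (by linarith)
  set η := 2 * ε / (3 * (2 * √B + 1) ^ 2) with hη
  have hηpos : 0 < η := by positivity
  have hηε : η * (2 * √B + 1) ^ 2 = 2 / 3 * ε := by
    rw [hη]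
    field_simp
  set N := ⌈32 * B⌉₊ with hN
  have hNB : 32 * B ≤ N := Nat.le_ceil _
  have hN0 : 0 < N := Nat.ceil_pos.mpr (by linarith)
  have hcheb := Program.prob_average_sequence_replicate hψ (P := sample A.toReadout) (μ := μ)
    (V := A.variance) (by
      rw [expect_sample]
      simp only [mul_sub, Finset.sum_sub_distrib, ← Finset.sum_mul, hψ]
      rw [one_mul, sub_eq_zero]
      exact hmean.symm) (by rw [expect_sample, hvar]) hN0 (d := μ / 2) (by positivity)
  -- The variance is at most `Bμ²` and `N ≥ 32B`, so the quotient is at most `4/32`.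
  have hcheb' : A.variance / (N * (μ / 2) ^ 2) ≤ 1 / 8 := by
    rw [div_le_iff₀ (by positivity)]
    nlinarith [mul_le_mul_of_nonneg_right hNB (sq_nonneg μ)]
  refine (Program.prob_bind_le hψ (δ := 1 / 8) (by norm_num) (fun l hl => ?_)).trans
    ((add_le_add_left (hcheb.trans hcheb') _).trans (by norm_num))
  set m := l.sum / N with hm
  have hmμ : |m - μ| < μ / 2 := not_le.mp hl
  rw [abs_lt] at hmμ
  have hm0 : 0 < m := by linarith [hmμ.1]
  change Program.prob _ _ ((powering 8 (1 / 8) (l2Mean D 8 (A.scale m) η)).bind fun x =>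
    Program.pure (m * x)) ≤ 1 / 8
  rw [Program.prob_bind_pure]
  -- For small `η` the probabilistic `ℓ₂` bound applies; for large `η` the tolerance `ε` exceeds
  -- every possible relative error once `m` is good.
  rcases lt_or_ge η (1 / 2) with hη2 | hη2
  · set S := ∑ b, ‖A.state b‖ ^ 2 * (X b / m) ^ 2 with hS
    have hSB : S ≤ 4 * (B + 1) := by
      have : S = (∑ b, ‖A.state b‖ ^ 2 * X b ^ 2) / m ^ 2 := by
        rw [hS, Finset.sum_div]
        exact Finset.sum_congr rfl fun b _ => by rw [div_pow, mul_div_assoc]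
      rw [this, div_le_iff₀ (by positivity)]
      nlinarith [mul_le_mul_of_nonneg_left (show μ ^ 2 ≤ 4 * m ^ 2 by nlinarith [hmμ.1])
        (show 0 ≤ B + 1 by linarith)]
    have hsS : √S ≤ 3 * √B := by
      rw [Real.sqrt_le_left (by positivity), mul_pow, hsB2]
      linarith
    have hP := prob_l2Mean_le (ψ := A.state) (A.scale m) hψ
      (fun b hb => div_nonneg (hA _ (A.outcomeProb_pos hb)) hm0.le) (D := D) (by linarith) hηpos hη2
      (M := μ / m) (by
        rw [hmean, Finset.sum_div]
        exact Finset.sum_congr rfl fun b _ => mul_div_assoc _ _ _) hS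
    refine (Program.prob_mono ?_ _).trans
      (prob_powering_le hψ (by norm_num) (ordConnected_abs_sub_le _ _) hP)
    intro x hx hx'
    -- Since `√S ≤ 3√B` and `√B ≥ 1`, the numerator is at most `1474√B`; this is where `D = 1500`
    -- comes from.
    have hD' : (64 * √S + 1282) / D ≤ √B := by
      rw [div_le_iff₀ (by linarith)]
      nlinarith
    have herr : |x - μ / m| ≤ 2 / 3 * ε := by
      refine hx'.trans ?_
      rw [← hηε]
      -- It remains that `4(B+1) + √B ≤ (2√B+1)²`, which amounts to `√B ≥ 1`.
      refine mul_le_mul_of_nonneg_left ?_ hηpos.le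
      nlinarith
    have hx2 : ε * μ ≤ |m * x - μ| := hx
    have e : m * x - μ = m * (x - μ / m) := by field_simp
    rw [e, abs_mul, abs_of_pos hm0] at hx2
    -- The strict bound `m < 3μ/2` against the error `2ε/3` contradicts an error of at least `εμ`.
    nlinarith [hmμ.2, abs_nonneg (x - μ / m)]
  · rw [(always_powering (I := Set.Icc 0 3) ⟨le_rfl, by norm_num⟩ (always_l2Mean (A.scale m) D 8 hη2)).prob_eq_zero]
    · norm_num
    · intro x hx hx2
      -- From `(2√B+1)² ≥ 9` and `η ≥ 1/2` one gets `2ε/3 ≥ 9/2`.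
      have hε2 : 27 / 4 ≤ ε := by
        have h9 : 3 ^ 2 ≤ (2 * √B + 1) ^ 2 := pow_le_pow_left₀ (by norm_num) (by linarith) 2
        have := mul_le_mul hη2 h9 (by norm_num) hηpos.le
        linarith
      have hx3 : ε * μ ≤ |m * x - μ| := hx2
      have : |m * x - μ| < 27 / 4 * μ := by
        have h1 : 0 ≤ m * x := mul_nonneg hm0.le hx.1
        have h2 : m * x ≤ m * 3 := mul_le_mul_of_nonneg_left hx.2 hm0.le
        rw [abs_lt]
        constructor <;> linarith [hmμ.2]
      exact absurd (hx3.trans_lt this) (not_lt.mpr (mul_le_mul_of_nonneg_right hε2 hμ.le))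

end RelativeMean

/-! ### The costs of the estimation algorithms -/

theorem one_le_clampLog (x : ℝ) : 1 ≤ clampLog x := le_max_left _ _

theorem log_le_clampLog (x : ℝ) : Real.log x ≤ clampLog x := le_max_right _ _

theorem repetitions_le {δ b : ℝ} (hb : 0 ≤ b) (h : Real.log (1 / δ) ≤ b) :
    (repetitions 8 δ : ℝ) ≤ 8 * b + 1 := by
  have h1 : 8 * Real.log (1 / δ) ≤ 8 * b := by linarith
  calc (repetitions 8 δ : ℝ) ≤ (⌈8 * b⌉₊ : ℝ) := Nat.cast_le.mpr (Nat.ceil_mono h1)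
    _ ≤ 8 * b + 1 := (Nat.ceil_lt_add_one (by linarith)).le

/-- Because `2 ≤ e`, numerical logarithms can be bounded by comparison with powers of two. -/
theorem log_le_natCast {x : ℝ} {m : ℕ} (hx : 0 < x) (h : x ≤ 2 ^ m) : Real.log x ≤ m := by
  have h1 : (2 : ℝ) ≤ Real.exp 1 := by linarith [Real.add_one_le_exp 1]
  rw [Real.log_le_iff_le_exp hx, ← mul_one (m : ℝ), Real.exp_nat_mul]
  exact h.trans (pow_le_pow_left₀ zero_le_two h1 m)

/-- The number of runs of amplitude estimation in `l2Mean` with accuracy `η`. -/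
def l2Runs (c η : ℝ) : ℕ :=
  repetitions c (1 / 10) +
    ⌈Real.logb 2 (1 / η)⌉₊ * repetitions c (1 / (10 * ⌈Real.logb 2 (1 / η)⌉₊))

section Costs

variable {n k : ℕ}

theorem copies_l2Mean_le (D c η : ℝ) (A : Readout n k) : (l2Mean D c A η).copies ≤ l2Runs c η := by
  refine (Program.copies_bind_le (Program.always_true _) fun μ₀ _ =>
    (Program.copies_bind_pure _ _).trans (Program.copies_sequence_le
      (b := repetitions c (1 / (10 * ⌈Real.logb 2 (1 / η)⌉₊))) _ fun P hP => ?_)).trans ?_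
  · obtain ⟨i, _, rfl⟩ := List.mem_map.mp hP
    exact (Program.copies_bind_pure _ _).trans (copies_boundedMean_le _ _ _ _ _)
  · rw [List.length_map, List.length_range]
    exact add_le_add_left (copies_boundedMean_le _ _ _ _ _) _

theorem uses_l2Mean_le (D c η : ℝ) (A : Readout n k) :
    (l2Mean D c A η).uses ≤ l2Runs c η * (⌈D * √(Real.logb 2 (1 / η)) / η⌉₊ - 1) := by
  refine (Program.uses_bind_le (Program.always_true _) fun μ₀ _ =>
    (Program.uses_bind_pure _ _).trans (Program.uses_sequence_le
      (b := repetitions c (1 / (10 * ⌈Real.logb 2 (1 / η)⌉₊)) *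
        (⌈D * √(Real.logb 2 (1 / η)) / η⌉₊ - 1)) _ fun P hP => ?_)).trans ?_
  · obtain ⟨i, _, rfl⟩ := List.mem_map.mp hP
    exact (Program.uses_bind_pure _ _).trans (uses_boundedMean_le _ _ _ _ _)
  · rw [List.length_map, List.length_range, l2Runs, add_mul, mul_assoc]
    exact add_le_add_left (uses_boundedMean_le _ _ _ _ _) _

theorem copies_sample (A : Readout n k) : (sample A).copies = 1 := by
  simp [sample, Program.copies]

theorem uses_sample (A : Readout n k) : (sample A).uses = 0 := by
  simp [sample, Program.uses]

theorem copies_relativeMean_le (D c : ℝ) (A : Readout n k) (B ε : ℝ) :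
    (relativeMean D c A B ε).copies ≤ ⌈32 * B⌉₊ +
      repetitions c (1 / 8) * l2Runs c (2 * ε / (3 * (2 * √B + 1) ^ 2)) := by
  refine (Program.copies_bind_le (Program.always_true _) fun l _ =>
    (Program.copies_bind_pure _ _).trans ((copies_powering_le _ _ _).trans
      (Nat.mul_le_mul_left _ (copies_l2Mean_le _ _ _ _)))).trans (add_le_add_left ?_ _)
  refine (Program.copies_sequence_le (b := 1) _ fun P hP => ?_).trans_eq (by simp)
  rw [List.eq_of_mem_replicate hP, copies_sample]

theorem uses_relativeMean_le (D c : ℝ) (A : Readout n k) (B ε : ℝ) :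
    (relativeMean D c A B ε).uses ≤
      repetitions c (1 / 8) * (l2Runs c (2 * ε / (3 * (2 * √B + 1) ^ 2)) *
        (⌈D * √(Real.logb 2 (1 / (2 * ε / (3 * (2 * √B + 1) ^ 2)))) /
          (2 * ε / (3 * (2 * √B + 1) ^ 2))⌉₊ - 1)) := by
  refine (Program.uses_bind_le (Program.always_true _) fun l _ =>
    (Program.uses_bind_pure _ _).trans ((uses_powering_le _ _ _).trans
      (Nat.mul_le_mul_left _ (uses_l2Mean_le _ _ _ _)))).trans
        ((add_le_add_left (c := 0) ?_ _).trans_eq (zero_add _))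
  refine (Program.uses_sequence_le (b := 0) _ fun P hP => ?_).trans_eq (by simp)
  rw [List.eq_of_mem_replicate hP, uses_sample]

end Costs

/-! ### From repetition counts to logarithmic bounds -/

theorem repetitions_one_div_eight_le : (repetitions 8 (1 / 8) : ℝ) ≤ 25 := by
  have : Real.log (1 / (1 / 8)) ≤ (3 : ℕ) := log_le_natCast (by norm_num) (by norm_num)
  refine (repetitions_le (by norm_num) this).trans ?_
  norm_num

theorem logb_inv_accuracy_le {η x : ℝ} (hη : 0 < η) (hx : 0 < x) (h : 1 / η ≤ 27 / 2 * x) :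
    Real.logb 2 (1 / η) ≤ 10 * clampLog x := by
  have h1 : Real.log (27 / 2 : ℝ) ≤ (4 : ℕ) := log_le_natCast (by norm_num) (by norm_num)
  have h2 : Real.log (1 / η) ≤ 5 * clampLog x := by
    calc Real.log (1 / η) ≤ Real.log (27 / 2 * x) := Real.log_le_log (by positivity) h
      _ = Real.log (27 / 2) + Real.log x := Real.log_mul (by norm_num) hx.ne'
      _ ≤ 4 * clampLog x + clampLog x := by
        push_cast at h1
        linarith [one_le_clampLog x, log_le_clampLog x]
      _ = _ := by ring
  have h3 := Real.log_two_gt_d9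
  rw [Real.logb, div_le_iff₀ (by linarith)]
  nlinarith [one_le_clampLog x]

/-- The number of levels gives one logarithm; the failure probability `1/(10K)` demanded of each
level gives the iterated one. -/
theorem l2Runs_le {η x : ℝ} (hη : 0 < η) (hx : 0 < x) (h : 1 / η ≤ 27 / 2 * x) :
    (l2Runs 8 η : ℝ) ≤ 1000 * (clampLog x * clampLog (clampLog x)) := by
  set K := ⌈Real.logb 2 (1 / η)⌉₊ with hK
  have h1 := one_le_clampLog x
  have h2 := one_le_clampLog (clampLog x)
  have h12 : 1 ≤ clampLog x * clampLog (clampLog x) := one_le_mul_of_one_le_of_one_le h1 h2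
  have hlog := logb_inv_accuracy_le hη hx h
  have hKle : (K : ℝ) ≤ 11 * clampLog x := by
    calc (K : ℝ) ≤ (⌈10 * clampLog x⌉₊ : ℝ) := Nat.cast_le.mpr (Nat.ceil_mono hlog)
      _ ≤ 10 * clampLog x + 1 := (Nat.ceil_lt_add_one (by linarith)).le
      _ ≤ _ := by linarith
  have hr10 : (repetitions 8 (1 / 10) : ℝ) ≤ 33 := by
    have : Real.log (1 / (1 / 10)) ≤ (4 : ℕ) := log_le_natCast (by norm_num) (by norm_num)
    refine (repetitions_le (by norm_num) this).trans ?_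
    norm_num
  have hKr : (K : ℝ) * repetitions 8 (1 / (10 * K)) ≤
      11 * clampLog x * (73 * clampLog (clampLog x)) := by
    rcases Nat.eq_zero_or_pos K with h0 | hpos
    · rw [h0, Nat.cast_zero, zero_mul]
      positivity
    · have hK0 : (0 : ℝ) < K := Nat.cast_pos.mpr hpos
      refine mul_le_mul hKle ?_ (Nat.cast_nonneg _) (by linarith)
      have h3 : Real.log (1 / (1 / (10 * K))) ≤ 9 * clampLog (clampLog x) := by
        rw [one_div_one_div]
        have h110 : Real.log 110 ≤ (7 : ℕ) := log_le_natCast (by norm_num) (by norm_num)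
        push_cast at h110
        calc Real.log (10 * K) ≤ Real.log (110 * clampLog x) :=
              Real.log_le_log (by positivity) (by linarith)
          _ = Real.log 110 + Real.log (clampLog x) := Real.log_mul (by norm_num) (by linarith)
          _ ≤ _ := by linarith [log_le_clampLog (clampLog x)]
      refine (repetitions_le (by linarith) h3).trans ?_
      linarith
  rw [l2Runs]
  push_cast
  linarith

/-- Either `log B` is at most the clamped `log(1/ε)`, and replacing `B/ε` by `1/ε` costs a factor
`2` in each logarithm; or `log B` dominates, and the product is at most `4 log² B ≤ 16B`, so the
term `B` absorbs it. -/
theorem clampLog_mul_clampLog_clampLog_div_le {B ε : ℝ} (hB : 1 ≤ B) (hε : 0 < ε) :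
    clampLog (B / ε) * clampLog (clampLog (B / ε)) ≤
      16 * (B + clampLog (1 / ε) * clampLog (clampLog (1 / ε))) := by
  set ℓ := clampLog (B / ε) with hℓ
  set y := clampLog (1 / ε) with hy
  have hy1 : 1 ≤ y := one_le_clampLog _
  have hℓ1 : 1 ≤ ℓ := one_le_clampLog _
  have hyy : 1 ≤ clampLog y := one_le_clampLog _
  have hlogB : 0 ≤ Real.log B := Real.log_nonneg hB
  have hle : ℓ ≤ Real.log B + y := by
    refine max_le (by linarith) ?_
    rw [div_eq_mul_one_div, Real.log_mul (by linarith) (by positivity)]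
    linarith [log_le_clampLog (1 / ε)]
  rcases le_or_gt (Real.log B) y with h | h
  · have h1 : clampLog ℓ ≤ 2 * clampLog y := by
      refine max_le (by linarith) ?_
      calc Real.log ℓ ≤ Real.log (2 * y) := Real.log_le_log (by linarith) (by linarith)
        _ = Real.log 2 + Real.log y := Real.log_mul (by norm_num) (by linarith)
        _ ≤ _ := by linarith [Real.log_two_lt_d9, log_le_clampLog y]
    have h2 : ℓ * clampLog ℓ ≤ (2 * y) * (2 * clampLog y) :=
      mul_le_mul (by linarith) h1 (zero_le_one.trans (one_le_clampLog _)) (by linarith)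
    have h3 : 0 ≤ y * clampLog y := by positivity
    linarith
  · have h1 : clampLog ℓ ≤ ℓ := max_le hℓ1 (Real.log_le_self (by linarith))
    have h2 : ℓ * clampLog ℓ ≤ (2 * Real.log B) * (2 * Real.log B) :=
      mul_le_mul (by linarith) (by linarith) (zero_le_one.trans (one_le_clampLog _)) (by linarith)
    -- This is `log x ≤ x` at `x = √B`.
    have h3 : Real.log B ≤ 2 * √B := by
      have := Real.log_le_self (Real.sqrt_nonneg B)
      rw [Real.log_sqrt (by linarith)] at this
      linarith
    have h4 : Real.log B ^ 2 ≤ 4 * B := by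
      calc Real.log B ^ 2 ≤ (2 * √B) ^ 2 := pow_le_pow_left₀ hlogB h3 2
        _ = 4 * B := by rw [mul_pow, Real.sq_sqrt (by linarith)]; norm_num
    have h5 : 0 ≤ y * clampLog y := by positivity
    linarith

theorem one_div_accuracy_le {B ε : ℝ} (hB : 1 ≤ B) (hε : 0 < ε) :
    1 / (2 * ε / (3 * (2 * √B + 1) ^ 2)) ≤ 27 / 2 * (B / ε) := by
  have hsB : 1 ≤ √B := Real.one_le_sqrt.mpr hB
  have h9 : (2 * √B + 1) ^ 2 ≤ 9 * B := by
    calc (2 * √B + 1) ^ 2 ≤ (3 * √B) ^ 2 := pow_le_pow_left₀ (by positivity) (by linarith) 2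
      _ = 9 * B := by rw [mul_pow, Real.sq_sqrt (by linarith)]; norm_num
  rw [one_div_div]
  calc 3 * (2 * √B + 1) ^ 2 / (2 * ε) ≤ 3 * (9 * B) / (2 * ε) := by gcongr
    _ = _ := by field_simp; norm_num

theorem copies_relativeMean_le_of_one_le {n k : ℕ} (D : ℝ) (A : Readout n k) {B ε : ℝ}
    (hB : 1 ≤ B) (hε : 0 < ε) :
    ((relativeMean D 8 A B ε).copies : ℝ) ≤
      10 ^ 6 * (B + clampLog (1 / ε) * clampLog (clampLog (1 / ε))) := by
  have hη : 0 < 2 * ε / (3 * (2 * √B + 1) ^ 2) := by positivity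
  have hruns := l2Runs_le hη (x := B / ε) (by positivity) (one_div_accuracy_le hB hε)
  have hlog := clampLog_mul_clampLog_clampLog_div_le hB hε
  have hceil : (⌈32 * B⌉₊ : ℝ) ≤ 32 * B + 1 := (Nat.ceil_lt_add_one (by linarith)).le
  have hy : 0 ≤ clampLog (1 / ε) * clampLog (clampLog (1 / ε)) :=
    mul_nonneg (zero_le_one.trans (one_le_clampLog _)) (zero_le_one.trans (one_le_clampLog _))
  have h : ((relativeMean D 8 A B ε).copies : ℝ) ≤ _ :=
    Nat.cast_le.mpr (copies_relativeMean_le D 8 A B ε)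
  push_cast at h
  have h2 := mul_le_mul repetitions_one_div_eight_le hruns (Nat.cast_nonneg _) (by norm_num)
  linarith

theorem uses_relativeMean_le_of_one_le {n k : ℕ} (A : Readout n k) {B ε : ℝ}
    (hB : 1 ≤ B) (hε : 0 < ε) :
    ((relativeMean 1500 8 A B ε).uses : ℝ) ≤
      10 ^ 10 * ((B / ε) * clampLog (B / ε) ^ (3 / 2 : ℝ) * clampLog (clampLog (B / ε))) := by
  set η := 2 * ε / (3 * (2 * √B + 1) ^ 2) with hη'
  have hη : 0 < η := by positivity
  set x := B / ε with hx'
  have hx : 0 < x := by positivity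
  have hxη : 1 / η ≤ 27 / 2 * x := one_div_accuracy_le hB hε
  have hruns := l2Runs_le hη hx hxη
  set ℓ := clampLog x with hℓ
  have hℓ1 : 1 ≤ ℓ := one_le_clampLog _
  have hℓℓ : 1 ≤ clampLog ℓ := one_le_clampLog _
  have ht : ((⌈1500 * √(Real.logb 2 (1 / η)) / η⌉₊ - 1 : ℕ) : ℝ) ≤ 1500 * (4 * √ℓ) * (27 / 2 * x) := by
    have hs : √(Real.logb 2 (1 / η)) ≤ 4 * √ℓ := by
      have : 4 * √ℓ = √(16 * ℓ) := by
        rw [Real.sqrt_mul (by norm_num), show (16 : ℝ) = 4 ^ 2 by norm_num,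
          Real.sqrt_sq (by norm_num)]
      rw [this]
      exact Real.sqrt_le_sqrt ((logb_inv_accuracy_le hη hx hxη).trans (by linarith))
    -- Amplitude estimation with `t` iterations uses `U` only `t - 1` times, which absorbs the
    -- rounding up. The bound thus stays proportional to `B/ε` with no additive constant, even when
    -- `B/ε` is small.
    have h1 : ((⌈1500 * √(Real.logb 2 (1 / η)) / η⌉₊ - 1 : ℕ) : ℝ) ≤
        1500 * √(Real.logb 2 (1 / η)) / η := by
      have h2 : 0 ≤ 1500 * √(Real.logb 2 (1 / η)) / η := by positivity
      have h3 := Nat.ceil_lt_add_one h2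
      rcases Nat.eq_zero_or_pos ⌈1500 * √(Real.logb 2 (1 / η)) / η⌉₊ with h0 | h0
      · rw [h0]
        simpa using h2
      · rw [Nat.cast_sub h0, Nat.cast_one]
        linarith
    refine h1.trans ?_
    rw [div_eq_mul_one_div]
    gcongr
  have hpow : ℓ ^ (3 / 2 : ℝ) = ℓ * √ℓ := by
    rw [Real.sqrt_eq_rpow, show (3 / 2 : ℝ) = 1 + 1 / 2 by norm_num,
      Real.rpow_add (by linarith), Real.rpow_one]
  have h : ((relativeMean 1500 8 A B ε).uses : ℝ) ≤ _ :=
    Nat.cast_le.mpr (uses_relativeMean_le 1500 8 A B ε)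
  rw [Nat.cast_mul, Nat.cast_mul] at h
  refine h.trans ?_
  calc (repetitions 8 (1 / 8) : ℝ) * (l2Runs 8 η *
        ((⌈1500 * √(Real.logb 2 (1 / η)) / η⌉₊ - 1 : ℕ) : ℝ))
      ≤ 25 * (1000 * (ℓ * clampLog ℓ) * (1500 * (4 * √ℓ) * (27 / 2 * x))) := by
        gcongr
        exact repetitions_one_div_eight_le
    _ = 2025000000 * (x * (ℓ * √ℓ) * clampLog ℓ) := by ring
    _ ≤ _ := by
        rw [hpow]
        have : 0 ≤ x * (ℓ * √ℓ) * clampLog ℓ := by positivity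
        linarith

end QMean

end

theorem mainTheorem2 :
    ∃ D c K : ℝ, 0 < D ∧ 0 < c ∧ 0 < K ∧
      ∀ (n k : ℕ) (A : QMean.QuantumAlgorithm n k) (B ε : ℝ),
        1 ≤ B → 0 < ε → ε < 27 * B / 4 →
        (∀ x, 0 < A.outcomeProb x → 0 ≤ A.value x) →
        0 < A.mean → A.variance / A.mean ^ 2 ≤ B →
          (QMean.relativeMean D c A.toReadout B ε).prob A.state
              {μ | ε * A.mean ≤ |μ - A.mean|} ≤ 1 / 4 ∧
          ((QMean.relativeMean D c A.toReadout B ε).copies : ℝ) ≤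
            K * (B + QMean.clampLog (1 / ε) * QMean.clampLog (QMean.clampLog (1 / ε))) ∧
          ((QMean.relativeMean D c A.toReadout B ε).uses : ℝ) ≤
            K * ((B / ε) * QMean.clampLog (B / ε) ^ (3 / 2 : ℝ) *
              QMean.clampLog (QMean.clampLog (B / ε))) := by
  refine ⟨1500, 8, 10 ^ 10, by norm_num, by norm_num, by norm_num, fun n k A B ε hB hε _ hA hμ hV =>
    ⟨QMean.prob_relativeMean_le A le_rfl hB hε hA hμ hV, ?_,
      QMean.uses_relativeMean_le_of_one_le A.toReadout hB hε⟩⟩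
  refine (QMean.copies_relativeMean_le_of_one_le 1500 A.toReadout hB hε).trans ?_
  have := mul_nonneg (zero_le_one.trans (QMean.one_le_clampLog (1 / ε)))
    (zero_le_one.trans (QMean.one_le_clampLog (QMean.clampLog (1 / ε))))
  gcongr
  · linarith
  · norm_num
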